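/- All graphs are finite, simple and undirected; $|G|$ is the number of vertices of $G$, $N_G(v)$ is the set of neighbors of $v$, $N_G[v]=N_G(v)\cup\{v\}$, and $N_G[P]=\bigcup_{v\in P}N_G[v]$ for $P\subseteq V(G)$. A graph class is a set of graphs. *Transductions.* A (first-order) transduction $\mathsf T=(m,\Lambda,\psi)$ consists of a number $m\in\mathbb N$, a finite set $\Lambda$ of unary predicates and a first-order formula $\psi(x,y)$ over the signature $\{\mathsf{adj},\mathsf{cp}\}\cup\Lambda$. For a graph $G$, the class $\mathsf T(G)$ consists of all graphs $H$ obtained (up to isomorphism) as follows: form the structure on $V(G)\times[m]$ in which $\mathsf{adj}((u,i),(v,j))$ holds iff $i=j$ and $uv\in E(G)$, and $\mathsf{cp}((u,i),(v,j))$ holds iff $u=v$; interpret the predicates in $\Lambda$ as arbitrary subsets of $V(G)\times[m]$; take the graph on $V(G)\times[m]$ in which distinct $a,b$ are adjacent iff $\psi(a,b)\vee\psi(b,a)$ holds; and take an arbitrary induced subgraph. Put $\mathsf T(\mathscr C)=\bigcup_{G\in\mathscr C}\mathsf T(G)$. A class $\mathscr D$ is transducible from $\mathscr C$ if $\mathscr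 D\subseteq\mathsf T(\mathscr C)$ for some transduction $\mathsf T$. *Assumptions on classes.* $\mathscr C$ is *monadically stable* if the class of all half-graphs $H_t$ is not transducible from $\mathscr C$, where $H_t$ has vertices $u_1,\dots,u_t,v_1,\dots,v_t$ and edges $u_iv_j$ for $1\le i\le j\le t$. A class $\mathscr D$ has *linear neighborhood complexity* if there is $c$ with $|\{N_G(v)\cap S: v\in V(G)\}|\le c\cdot|S|$ for all $G\in\mathscr D$ and all nonempty $S\subseteq V(G)$; $\mathscr C$ has *inherently linear neighborhood complexity* if $\mathsf T(\mathscr C)$ has linear neighborhood complexity for every transduction $\mathsf T$. *Covers.* A *neighborhood cover* of $G$ is a collection $\mathcal X$ of subsets of $V(G)$ (clusters) such that for each $v\in V(G)$ there is $X\in\mathcal X$ with $N_G[v]\subseteq X$. It is *compact* if there is a partition $\mathcal P$ of $V(G)$ such that (i) for each $P\in\mathcal P$ there is $u\in V(G)$ with $P\subseteq N_G[u]$, and (ii) each $X\in\mathcal X$ equals $N_G[P]$ for some $P\in\mathcal P$. It has *overlap at most $k$* if every vertex is contained in at most $k$ clusters of $\mathcal X$. **Lemma.** Let $\mathscr C$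 be a monadically stable graph class with inherently linear neighborhood complexity. Then there are a constant $k\in\mathbb N$ and an algorithm that, given the adjacency matrix of any $G\in\mathscr C$ (for any numbering of its vertices), computes a compact neighborhood cover of $G$ of overlap at most $k$ in time $\mathcal O(|G|^4)$. Here an algorithm is a program for a unit-cost word RAM with words of $\mathcal O(\log |G|)$ bits, which outputs the characteristic vectors of the clusters; $k$, the program, and the constants hidden in the $\mathcal O$-notation depend only on $\mathscr C$. -/

import Mathlib

namespace CompactCovers

/-! ### Graphs and graph classes -/

/-- A finite simple undirected graph.  A graph class is a `Set FinGraph`. -/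
structure FinGraph where
  /-- the vertex set -/
  V : Type
  [finite : Finite V]
  /-- the edges -/
  graph : SimpleGraph V

attribute [instance] FinGraph.finite

/-- The number `|G|` of vertices. -/
noncomputable def FinGraph.order (G : FinGraph) : ℕ := Nat.card G.V

/-- The half-graph of order `t`: vertices `u_i = inl i` and `v_j = inr j`, and the edges
`u_i v_j` with `i ≤ j`. -/
def halfGraph (t : ℕ) : FinGraph where
  V := Fin t ⊕ Fin t
  graph := SimpleGraph.fromRel fun a b => ∃ i j : Fin t, a = Sum.inl i ∧ b = Sum.inr j ∧ i ≤ j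

/-! ### First-order transductions -/

/-- The relation symbols `adj`, `cp` (binary) and `m` unary colour predicates. -/
inductive CopyRel (m : ℕ) : ℕ → Type
  | adj : CopyRel m 2
  | cp : CopyRel m 2
  | color : Fin m → CopyRel m 1

/-- The relational signature `{adj, cp}` extended by `m` unary predicates. -/
abbrev copyLang (m : ℕ) : FirstOrder.Language.{0, 0} := ⟨fun _ => Empty, CopyRel m⟩

/-- The `k`-copy of `G`, with its vertices marked by the unary predicates `M 0, …, M (m - 1)`. -/
@[reducible] def coloredCopy {V : Type} (G : SimpleGraph V) (k : ℕ) {m : ℕ} (M : Fin m → Set (V × Fin k)) :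
    (copyLang m).Structure (V × Fin k) where
  funMap f := nomatch f
  RelMap r x := match r, x with
    | CopyRel.adj, x => (x 0).2 = (x 1).2 ∧ G.Adj (x 0).1 (x 1).1
    | CopyRel.cp, x => (x 0).1 = (x 1).1
    | CopyRel.color c, x => x 0 ∈ M c

/-- A first-order transduction: a number of copies, a number of unary predicates, and a first-order
formula in two free variables over `{adj, cp}` and these predicates. -/
structure Transduction where
  copies : ℕ
  colors : ℕ
  formula : (copyLang colors).Formula (Fin 2)

/-- The graph that the formula of the transduction defines on the `k`-copy of `G` marked by `M`:
distinct `u`, `v` are adjacent if and only if `ψ(u,v) ∨ ψ(v,u)` holds. -/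
def Transduction.defGraph (T : Transduction) {V : Type} (G : SimpleGraph V)
    (M : Fin T.colors → Set (V × Fin T.copies)) : SimpleGraph (V × Fin T.copies) :=
  SimpleGraph.fromRel fun u v =>
    @FirstOrder.Language.Formula.Realize (copyLang T.colors) (V × Fin T.copies)
      (coloredCopy G T.copies M) (Fin 2) T.formula ![u, v]

/-- `T(G)`: all graphs isomorphic to an induced subgraph of a graph that the formula defines on
some marking of the `k`-copy of `G`. -/
def Transduction.outputs (T : Transduction) (G : FinGraph) : Set FinGraph :=
  {H | ∃ M : Fin T.colors → Set (G.V × Fin T.copies),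
    Nonempty (H.graph ↪g T.defGraph G.graph M)}

/-- `T(C)`, the union of all `T(G)` with `G ∈ C`. -/
def Transduction.image (T : Transduction) (C : Set FinGraph) : Set FinGraph :=
  ⋃ G ∈ C, T.outputs G

/-- The class `D` is transducible from the class `C`. -/
def IsTransducible (D C : Set FinGraph) : Prop := ∃ T : Transduction, D ⊆ T.image C

/-- The class of all half-graphs is not transducible from `C`. -/
def MonadicallyStable (C : Set FinGraph) : Prop := ¬ IsTransducible (Set.range halfGraph) C

/-! ### Neighborhood complexity -/

/-- Some constant `c` satisfies `|{N(v) ∩ S : v ∈ V(G)}| ≤ c * |S|` for all `G ∈ C` and all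
nonempty `S ⊆ V(G)`. -/
def LinearNbhdComplexity (C : Set FinGraph) : Prop :=
  ∃ c : ℕ, ∀ G ∈ C, ∀ S : Set G.V, S.Nonempty →
    (Set.range fun v : G.V => G.graph.neighborSet v ∩ S).ncard ≤ c * S.ncard

/-- All classes `T(C)` have linear neighborhood complexity. -/
def InherentlyLinearNbhdComplexity (C : Set FinGraph) : Prop :=
  ∀ T : Transduction, LinearNbhdComplexity (T.image C)

/-! ### Neighborhood covers -/

section Covers

variable {V : Type}

/-- The closed neighborhood `N[v]` of a vertex. -/
def closedNbhd (G : SimpleGraph V) (v : V) : Set V := insert v (G.neighborSet v)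

/-- The closed neighborhood `N[P]` of a set of vertices. -/
def closedNbhdSet (G : SimpleGraph V) (P : Set V) : Set V := ⋃ v ∈ P, closedNbhd G v

/-- `X` is a neighborhood cover of `G`. -/
def IsNbhdCover (G : SimpleGraph V) (X : Set (Set V)) : Prop :=
  ∀ v : V, ∃ A ∈ X, closedNbhd G v ⊆ A

/-- Compactness of a neighborhood cover `X` of `G`. -/
def IsCompactCover (G : SimpleGraph V) (X : Set (Set V)) : Prop :=
  ∃ P : Set (Set V), Setoid.IsPartition P ∧
    (∀ B ∈ P, ∃ u : V, B ⊆ closedNbhd G u) ∧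
    (∀ A ∈ X, ∃ B ∈ P, A = closedNbhdSet G B)

/-- Every vertex lies in at most `k` clusters of `X`. -/
def OverlapAtMost (X : Set (Set V)) (k : ℕ) : Prop :=
  ∀ v : V, {A ∈ X | v ∈ A}.encard ≤ k

end Covers

/-! ### Word RAM -/

/-- A state of the random access machine: the registers, and a memory that is accessed indirectly,
through addresses held in registers. -/
structure RamState where
  reg : ℕ → ℕ
  mem : ℕ → ℕ

/-- Write the value `v` to the register `r`. -/
def RamState.setReg (s : RamState) (r v : ℕ) : RamState :=
  { s with reg := Function.update s.reg r v }

/-- Write the value `v` to the memory cell with address `a`. -/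
def RamState.setMem (s : RamState) (a v : ℕ) : RamState :=
  { s with mem := Function.update s.mem a v }

/-- Programs of the random access machine.  The arguments of the instructions are numbers of
registers, except for the constant `v` in `const r v`. -/
inductive RamProg
  /-- do nothing -/
  | skip : RamProg
  /-- `r := v` -/
  | const (r v : ℕ) : RamProg
  /-- `r := a + b` -/
  | add (r a b : ℕ) : RamProg
  /-- `r := max (a - b) 0` -/
  | sub (r a b : ℕ) : RamProg
  /-- `r := a * b` -/
  | mul (r a b : ℕ) : RamProg
  /-- `r := memory[a]` -/
  | load (r a : ℕ) : RamProg
  /-- `memory[a] := b` -/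
  | store (a b : ℕ) : RamProg
  /-- `p; q` -/
  | seq (p q : RamProg) : RamProg
  /-- `if a ≠ 0 then p else q` -/
  | ite (a : ℕ) (p q : RamProg) : RamProg
  /-- `while a ≠ 0 do p` -/
  | loop (a : ℕ) (p : RamProg) : RamProg

/-- `RamExec W p s t s'`: started in the state `s`, the program `p` halts in the state `s'` after
exactly `t` steps, on a machine whose words hold the numbers below `W`.  Every instruction and every
evaluation of a test takes one step.  A program that tries to write a number `≥ W` gets stuck. -/
inductive RamExec (W : ℕ) : RamProg → RamState → ℕ → RamState → Prop
  | skip (s : RamState) : RamExec W .skip s 1 s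
  | const (s : RamState) (r v : ℕ) (h : v < W) : RamExec W (.const r v) s 1 (s.setReg r v)
  | add (s : RamState) (r a b : ℕ) (h : s.reg a + s.reg b < W) :
      RamExec W (.add r a b) s 1 (s.setReg r (s.reg a + s.reg b))
  | sub (s : RamState) (r a b : ℕ) (h : s.reg a - s.reg b < W) :
      RamExec W (.sub r a b) s 1 (s.setReg r (s.reg a - s.reg b))
  | mul (s : RamState) (r a b : ℕ) (h : s.reg a * s.reg b < W) :
      RamExec W (.mul r a b) s 1 (s.setReg r (s.reg a * s.reg b))
  | load (s : RamState) (r a : ℕ) (h : s.mem (s.reg a) < W) :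
      RamExec W (.load r a) s 1 (s.setReg r (s.mem (s.reg a)))
  | store (s : RamState) (a b : ℕ) (h : s.reg b < W) :
      RamExec W (.store a b) s 1 (s.setMem (s.reg a) (s.reg b))
  | seq {p q : RamProg} {s s' s'' : RamState} {t t' : ℕ} :
      RamExec W p s t s' → RamExec W q s' t' s'' → RamExec W (.seq p q) s (t + t') s''
  | ite_true {a : ℕ} {p q : RamProg} {s s' : RamState} {t : ℕ} :
      s.reg a ≠ 0 → RamExec W p s t s' → RamExec W (.ite a p q) s (t + 1) s'
  | ite_false {a : ℕ} {p q : RamProg} {s s' : RamState} {t : ℕ} :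
      s.reg a = 0 → RamExec W q s t s' → RamExec W (.ite a p q) s (t + 1) s'
  | loop_stop {a : ℕ} {p : RamProg} {s : RamState} :
      s.reg a = 0 → RamExec W (.loop a p) s 1 s
  | loop_step {a : ℕ} {p : RamProg} {s s' s'' : RamState} {t t' : ℕ} :
      s.reg a ≠ 0 → RamExec W p s t s' → RamExec W (.loop a p) s' t' s'' →
      RamExec W (.loop a p) s (t + t' + 1) s''

/-- The number of values of a machine word on inputs with `n` vertices: words have
`d * log₂ (n + 2)` bits, that is, `O(log n)` for fixed `d`. -/
def wordBound (d n : ℕ) : ℕ := (n + 2) ^ d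

open Classical in
/-- The input: register `0` holds `n = |G|`, and the first `n * n` memory cells hold the adjacency
matrix of `G`, row by row, for the numbering `e` of the vertices.  All else is `0`. -/
noncomputable def inputState (G : FinGraph) (e : G.V ≃ Fin G.order) : RamState where
  reg r := if r = 0 then G.order else 0
  mem a := if ∃ u v : G.V, G.graph.Adj u v ∧ a = (e u : ℕ) * G.order + (e v : ℕ) then 1 else 0

/-- The collection of clusters that a final state describes: register `0` holds the number of
clusters, register `1` the address of the first of their characteristic vectors, which are stored
one after the other. -/
def outputClusters (G : FinGraph) (e : G.V ≃ Fin G.order) (s : RamState) : Set (Set G.V) :=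
  {A | ∃ i < s.reg 0, A = {v : G.V | s.mem (s.reg 1 + i * G.order + (e v : ℕ)) = 1}}

/-- On every graph `G` of the class `C`, given by its adjacency matrix for any numbering of the
vertices, the program `p` halts within `O(|G|^4)` steps, with words of `O(log |G|)` bits, and
outputs a compact neighborhood cover of `G` of overlap at most `k`. -/
def ComputesCompactCovers (p : RamProg) (C : Set FinGraph) (k : ℕ) : Prop :=
  ∃ c d : ℕ, ∀ G ∈ C, ∀ e : G.V ≃ Fin G.order, ∃ (t : ℕ) (s : RamState),
    RamExec (wordBound d G.order) p (inputState G e) t s ∧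
    t ≤ c * (G.order ^ 4 + 1) ∧
    IsNbhdCover G.graph (outputClusters G e s) ∧
    IsCompactCover G.graph (outputClusters G e s) ∧
    OverlapAtMost (outputClusters G e s) k

end CompactCovers

/-! Why the algorithm exists.

Let `N[v]` denote closed neighborhoods.  Suppose that the vertices are ordered, and let the center of
a vertex `w` be the first vertex of `N[w]`.  The sets of vertices with equal centers form a partition
into subsets of neighborhoods, and the neighborhoods of its parts form a compact neighborhood cover;
its overlap at `v` is at most the number of centers of vertices in `N[v]`.  So an order is needed for
which each `N[v]` contains vertices with boundedly many centers only.

The order is built from its end, by removing vertices from the set `S` of alive vertices, initially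
the set of all vertices.  By linear neighborhood complexity, the sets `N[w] ∩ S` are at most linearly
many, and a double counting argument in the style of Haussler's packing lemma
(`exists_near_twins`) shows that two vertices of `S` are near-twins: they are separated by
boundedly many of these sets.  The algorithm removes the first vertex `x` of a pair that is separated
by the least number of sets, and `x` becomes the center of all vertices in `N[x]`, replacing earlier
choices.  Thus every vertex `w` ends up with the vertex of `N[w]` that was removed last.

To bound the number of centers for `N[v]` (`card_image_center_le`), take vertices `w` in `N[v]` with
pairwise different centers, and pass from `v` to its near-twin, to the near-twin of that, and so on,
down to the first vertex.  The set of those `w` whose neighborhood contains the current vertex changes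
by boundedly many elements in each step, from everything to almost nothing.  If there are many `w`,
then such a walk yields a deep binary tree by repeated halving (`hasTree_of_walk`), and such a tree
yields a large half-graph (`HasTree.exists_ladder`).  Half-graphs of bounded order only occur by
monadic stability, since a half-graph between sequences of vertices of `G` can be transduced from `G`.

Each of the `n` removals takes time `O(n ^ 3)`: first a representative is chosen for each set
`N[w] ∩ S`, by comparing all pairs of rows of the matrix, and then the separating representatives are
counted for all pairs of vertices.  The program is verified with a small program logic (`Runs`) for
total correctness with time bounds. -/

namespace CompactCovers

open Finset

/-! ### Near-twins -/

section NearTwins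

variable {α β : Type*}

/-- A weighted form of the bound on the number of edges of the one-inclusion graph: if the sets of
nonzero weight shatter no set of more than `d` points, then the total weight of the edges
`{t, t ∪ {a}}`, where an edge weighs as much as the lighter of its ends, is at most `d` times the
total weight.  The induction splits the weights at a point `a` into the larger and the smaller weight
of `t` and `t ∪ {a}`. -/
theorem sum_min_insert_le [DecidableEq β] (A : Finset β) : ∀ (d : ℕ) (w : Finset β → ℕ),
    (∀ B ⊆ A, (∀ t ⊆ B, ∃ u ⊆ A, w u ≠ 0 ∧ u ∩ B = t) → #B ≤ d) →
    ∑ a ∈ A, ∑ t ∈ (A.erase a).powerset, min (w t) (w (insert a t)) ≤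
      d * ∑ t ∈ A.powerset, w t := by
  induction A using Finset.induction_on with
  | empty => intro d w _; simp
  | insert a A ha ih =>
    intro d w hsh
    set w₁ : Finset β → ℕ := fun t => max (w t) (w (insert a t)) with hw₁
    set w₂ : Finset β → ℕ := fun t => min (w t) (w (insert a t)) with hw₂
    have h₁ : ∑ b ∈ A, ∑ t ∈ (A.erase b).powerset, min (w₁ t) (w₁ (insert b t)) ≤
        d * ∑ t ∈ A.powerset, w₁ t := by
      refine ih d w₁ fun B hB hs => hsh B (hB.trans (subset_insert _ _)) fun t ht => ?_
      obtain ⟨u, hu, hwu, hut⟩ := hs t ht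
      have haB : a ∉ B := fun h => ha (hB h)
      by_cases h : w u = 0
      · refine ⟨insert a u, insert_subset_insert _ hu, ?_, ?_⟩
        · simp only [hw₁, h] at hwu; simpa using hwu
        · rw [insert_inter_of_notMem haB, hut]
      · exact ⟨u, hu.trans (subset_insert _ _), h, hut⟩
    have h₂ : ∑ b ∈ A, ∑ t ∈ (A.erase b).powerset, min (w₂ t) (w₂ (insert b t)) +
        ∑ t ∈ A.powerset, w₂ t ≤ d * ∑ t ∈ A.powerset, w₂ t := by
      -- a set shattered by the sets with both extensions yields a shattered set with one more point
      have key : ∀ B ⊆ A, (∀ t ⊆ B, ∃ u ⊆ A, w₂ u ≠ 0 ∧ u ∩ B = t) → #B + 1 ≤ d := by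
        intro B hB hs
        have haB : a ∉ B := fun h => ha (hB h)
        rw [← card_insert_of_notMem haB]
        refine hsh _ (insert_subset_insert _ hB) fun t ht => ?_
        obtain ⟨u, hu, hwu, hut⟩ := hs (t.erase a) (by
          intro x hx
          have := ht (mem_of_mem_erase hx)
          exact (mem_insert.1 this).resolve_left (ne_of_mem_erase hx))
        have hau : a ∉ u := fun h => ha (hu h)
        have hw : w u ≠ 0 ∧ w (insert a u) ≠ 0 := by
          simp only [hw₂] at hwu; omega
        by_cases hat : a ∈ t
        · refine ⟨insert a u, insert_subset_insert _ hu, hw.2, ?_⟩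
          rw [← insert_inter_distrib, hut, insert_erase hat]
        · refine ⟨u, hu.trans (subset_insert _ _), hw.1, ?_⟩
          rw [inter_insert_of_notMem hau, hut, erase_eq_of_notMem hat]
      by_cases hz : ∃ u ⊆ A, w₂ u ≠ 0
      · obtain ⟨u, hu, hwu⟩ := hz
        obtain ⟨d', rfl⟩ : ∃ d', d = d' + 1 := by
          have := key ∅ (empty_subset _) fun t ht => ⟨u, hu, hwu, by
            rw [subset_empty.1 ht, inter_empty]⟩
          exact ⟨d - 1, by simp at this; omega⟩
        have := ih d' w₂ fun B hB hs => by have := key B hB hs; omega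
        rw [add_mul, one_mul]
        omega
      · push Not at hz
        have e₁ : ∑ t ∈ A.powerset, w₂ t = 0 :=
          sum_eq_zero fun t ht => hz t (mem_powerset.1 ht)
        have e₂ : ∑ b ∈ A, ∑ t ∈ (A.erase b).powerset, min (w₂ t) (w₂ (insert b t)) = 0 :=
          sum_eq_zero fun b _ => sum_eq_zero fun t ht => by
            rw [hz t ((mem_powerset.1 ht).trans (erase_subset _ _)), Nat.zero_min]
        rw [e₁, e₂]; simp
    have hsum : ∑ t ∈ (insert a A).powerset, w t =
        ∑ t ∈ A.powerset, w₁ t + ∑ t ∈ A.powerset, w₂ t := by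
      rw [sum_powerset_insert ha, ← sum_add_distrib, ← sum_add_distrib]
      exact sum_congr rfl fun t _ => by simp only [hw₁, hw₂]; omega
    have hle : ∑ b ∈ A, ∑ t ∈ ((insert a A).erase b).powerset, min (w t) (w (insert b t)) ≤
        ∑ b ∈ A, ∑ t ∈ (A.erase b).powerset, min (w₁ t) (w₁ (insert b t)) +
        ∑ b ∈ A, ∑ t ∈ (A.erase b).powerset, min (w₂ t) (w₂ (insert b t)) := by
      rw [← sum_add_distrib]
      refine sum_le_sum fun b hb => ?_
      have hab : a ≠ b := fun h => ha (h ▸ hb)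
      rw [erase_insert_of_ne hab, sum_powerset_insert (fun h => ha (mem_of_mem_erase h)),
        ← sum_add_distrib, ← sum_add_distrib]
      refine sum_le_sum fun t _ => ?_
      simp only [hw₁, hw₂, Finset.insert_comm b a t]
      omega
    rw [sum_insert ha, erase_insert ha, hsum, mul_add]
    have : ∑ t ∈ A.powerset, min (w t) (w (insert a t)) = ∑ t ∈ A.powerset, w₂ t := rfl
    omega

variable (r : α → β → Prop) [∀ x, DecidablePred (r x)]

/-- If any two elements of `Q` are separated by at least `D` points of `P`, then a point of `P` splits
`Q` rather evenly on average.  Both sides times `|Q|` are compared with the number of triples of a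
pair of elements and a point separating it. -/
theorem card_sub_one_mul_le_sum_min [DecidableEq α] (Q : Finset α) (P : Finset β) (D : ℕ)
    (hD : ∀ x ∈ Q, ∀ y ∈ Q, x ≠ y → D ≤ #{p ∈ P | ¬(r x p ↔ r y p)}) :
    (#Q - 1) * D ≤ 2 * ∑ p ∈ P, min #{x ∈ Q | ¬ r x p} #{x ∈ Q | r x p} := by
  rcases Q.eq_empty_or_nonempty with rfl | hQ
  · simp
  have hpair : ∀ p, #{z ∈ Q ×ˢ Q | ¬(r z.1 p ↔ r z.2 p)} =
      2 * (#{x ∈ Q | ¬ r x p} * #{x ∈ Q | r x p}) := by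
    intro p
    have : {z ∈ Q ×ˢ Q | ¬(r z.1 p ↔ r z.2 p)} =
        ({x ∈ Q | ¬ r x p} ×ˢ {x ∈ Q | r x p}) ∪ ({x ∈ Q | r x p} ×ˢ {x ∈ Q | ¬ r x p}) := by
      ext ⟨x, y⟩; simp only [mem_filter, mem_product, mem_union]; tauto
    rw [this, card_union_of_disjoint, card_product, card_product]
    · ring
    · rw [disjoint_left]; rintro ⟨x, y⟩; simp only [mem_filter, mem_product]; tauto
  have hmin : ∀ p, #{x ∈ Q | ¬ r x p} * #{x ∈ Q | r x p} ≤
      #Q * min #{x ∈ Q | ¬ r x p} #{x ∈ Q | r x p} := by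
    intro p
    have h₁ : #{x ∈ Q | ¬ r x p} ≤ #Q := card_filter_le _ _
    have h₂ : #{x ∈ Q | r x p} ≤ #Q := card_filter_le _ _
    rcases le_total #{x ∈ Q | ¬ r x p} #{x ∈ Q | r x p} with h | h
    · rw [min_eq_left h, mul_comm]; exact Nat.mul_le_mul_right _ h₂
    · rw [min_eq_right h]; exact Nat.mul_le_mul_right _ h₁
  refine Nat.le_of_mul_le_mul_left ?_ hQ.card_pos
  calc #Q * ((#Q - 1) * D) = ∑ z ∈ Q.offDiag, D := by
        rw [sum_const, offDiag_card, smul_eq_mul, ← mul_assoc, Nat.mul_sub, mul_one]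
    _ ≤ ∑ z ∈ Q.offDiag, #{p ∈ P | ¬(r z.1 p ↔ r z.2 p)} :=
        sum_le_sum fun z hz => by
          rw [mem_offDiag] at hz; exact hD _ hz.1 _ hz.2.1 hz.2.2
    _ ≤ ∑ z ∈ Q ×ˢ Q, #{p ∈ P | ¬(r z.1 p ↔ r z.2 p)} :=
        sum_le_sum_of_subset (fun z hz => by
          rw [mem_offDiag] at hz; exact mem_product.2 ⟨hz.1, hz.2.1⟩)
    _ = ∑ p ∈ P, #{z ∈ Q ×ˢ Q | ¬(r z.1 p ↔ r z.2 p)} := by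
        simp only [card_filter]; exact sum_comm
    _ ≤ ∑ p ∈ P, 2 * (#Q * min #{x ∈ Q | ¬ r x p} #{x ∈ Q | r x p}) :=
        sum_le_sum fun p _ => by rw [hpair]; exact Nat.mul_le_mul_left _ (hmin p)
    _ = _ := by rw [← mul_sum, ← mul_sum]; ring

variable [DecidableEq β]

/-- The number of `x ∈ X` with trace `t` on `A`. -/
def traceCount (X : Finset α) (A t : Finset β) : ℕ := #{x ∈ X | A.filter (r x) = t}

theorem sum_traceCount (X : Finset α) (A : Finset β) :
    ∑ t ∈ A.powerset, traceCount r X A t = #X :=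
  (card_eq_sum_card_fiberwise fun _ _ =>
    mem_coe.2 (mem_powerset.2 (filter_subset _ _))).symm

/-- Choosing an `(m + 1)`-set and an element of it amounts to choosing an `m`-set and an element
outside of it. -/
theorem sum_powersetCard_succ (P : Finset β) (m : ℕ) (f : Finset β → β → ℕ) :
    ∑ A ∈ P.powersetCard (m + 1), ∑ a ∈ A, f (A.erase a) a =
      ∑ A ∈ P.powersetCard m, ∑ a ∈ P \ A, f A a := by
  rw [sum_sigma', sum_sigma']
  refine sum_bij' (fun z _ => ⟨z.1.erase z.2, z.2⟩) (fun z _ => ⟨insert z.2 z.1, z.2⟩) ?_ ?_ ?_ ?_ ?_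
  · rintro ⟨A, a⟩ h
    simp only [mem_sigma, mem_powersetCard, mem_sdiff] at h ⊢
    obtain ⟨⟨hA, hc⟩, ha⟩ := h
    exact ⟨⟨(erase_subset _ _).trans hA, by rw [card_erase_of_mem ha]; omega⟩, hA ha,
      notMem_erase _ _⟩
  · rintro ⟨A, a⟩ h
    simp only [mem_sigma, mem_powersetCard, mem_sdiff] at h ⊢
    obtain ⟨⟨hA, hc⟩, ha, ha'⟩ := h
    exact ⟨⟨insert_subset ha hA, by rw [card_insert_of_notMem ha']; omega⟩, mem_insert_self _ _⟩
  · rintro ⟨A, a⟩ h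
    simp only [mem_sigma] at h
    simp [insert_erase h.2]
  · rintro ⟨A, a⟩ h
    simp only [mem_sigma, mem_sdiff] at h
    simp [erase_insert h.2.2]
  · rintro ⟨A, a⟩ h; rfl

/-- Haussler's packing lemma for linear shatter functions: if the number of points is linear in the
number of elements, then some two elements are separated by a bounded number of points.  Otherwise,
consider for a set `A` of `m + 1` points, where `m` is proportional to `|X|`, the classes of elements
with equal traces on `A.erase a`, and count how evenly they are split by `a`, summed over all `A` and
`a ∈ A`.  This sum is bounded from above by `sum_min_insert_le`, and from below by
`card_sub_one_mul_le_sum_min`, since `m` points define at most `|X| / 2` classes. -/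
theorem exists_near_twins [DecidableEq α] (X : Finset α) (P : Finset β) (c d : ℕ) (hX : 2 ≤ #X)
    (hP : #P ≤ c * #X)
    (htr : ∀ A ⊆ P, #(X.image fun x => A.filter (r x)) ≤ c * (#A + 1))
    (hsh : ∀ B ⊆ P, (∀ t ⊆ B, ∃ x ∈ X, B.filter (r x) = t) → #B ≤ d) :
    ∃ x ∈ X, ∃ y ∈ X, x ≠ y ∧ #{p ∈ P | ¬(r x p ↔ r y p)} ≤ 16 * c ^ 2 * d + 2 * c ^ 2 := by
  by_contra hcon
  set D := 16 * c ^ 2 * d + 2 * c ^ 2 + 1 with hDdef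
  have hD : ∀ x ∈ X, ∀ y ∈ X, x ≠ y → D ≤ #{p ∈ P | ¬(r x p ↔ r y p)} :=
    fun x hx y hy hxy => Nat.lt_of_not_le fun h => hcon ⟨x, hx, y, hy, hxy, h⟩
  obtain ⟨x₀, hx₀, y₀, hy₀, hne⟩ := one_lt_card.1 hX
  have hDP : D ≤ #P := (hD x₀ hx₀ y₀ hy₀ hne).trans (card_filter_le _ _)
  have hsN : #X ≤ c * (#P + 1) := by
    rw [← card_image_of_injOn (s := X) (f := fun x => P.filter (r x))]
    · exact htr P Subset.rfl
    · intro x hx y hy hxy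
      by_contra h
      have h₁ := hD x hx y hy h
      have h₂ : {p ∈ P | ¬(r x p ↔ r y p)} = ∅ := by
        refine filter_eq_empty_iff.2 fun p hp => ?_
        have := congrArg (p ∈ ·) hxy
        simp only [mem_filter, hp, true_and, eq_iff_iff] at this
        simpa using this
      rw [h₂, card_empty] at h₁
      omega
  have hc : 1 ≤ c := by
    rcases Nat.eq_zero_or_pos c with rfl | h
    · simp at hsN; simp [hsN] at hX
    · exact h
  have hbig : 2 * c ≤ #X := by
    by_contra! h
    have : c * #X ≤ c * (2 * c) := Nat.mul_le_mul_left _ h.le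
    have : c * (2 * c) = 2 * c ^ 2 := by ring
    omega
  obtain ⟨m, hm₁, hm₂⟩ : ∃ m, 2 * c * (m + 1) ≤ #X ∧ #X ≤ 4 * c * (m + 1) := by
    refine ⟨#X / (2 * c) - 1, ?_⟩
    have h1 : 1 ≤ #X / (2 * c) := (Nat.one_le_div_iff (by omega)).2 hbig
    rw [Nat.sub_add_cancel h1]
    refine ⟨Nat.mul_div_le _ _, ?_⟩
    have h2 : #X < 2 * c * (#X / (2 * c) + 1) := by
      rw [mul_comm]; exact Nat.lt_mul_of_div_lt (Nat.lt_succ_self _) (by omega)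
    nlinarith
  have hmN : m + 1 ≤ #P := by
    have : 2 * c * (m + 1) ≤ c * (#P + 1) := hm₁.trans hsN
    have : c * (2 * (m + 1)) ≤ c * (#P + 1) := by linarith
    have := Nat.le_of_mul_le_mul_left this hc
    omega
  set f : Finset β → β → ℕ := fun A a =>
    ∑ t ∈ A.powerset, min (traceCount r X (insert a A) t) (traceCount r X (insert a A) (insert a t))
    with hf
  have hup : ∀ A ∈ P.powersetCard (m + 1), ∑ a ∈ A, f (A.erase a) a ≤ d * #X := by
    intro A hA
    rw [mem_powersetCard] at hA
    rw [← sum_traceCount r X A]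
    refine le_trans (le_of_eq ?_) (sum_min_insert_le A d (traceCount r X A) ?_)
    · exact sum_congr rfl fun a ha => by simp only [hf, insert_erase ha]
    · intro B hB hs
      refine hsh B (hB.trans hA.1) fun t ht => ?_
      obtain ⟨u, hu, hwu, hut⟩ := hs t ht
      obtain ⟨x, hx⟩ := card_ne_zero.1 hwu
      rw [mem_filter] at hx
      refine ⟨x, hx.1, ?_⟩
      rw [← hut, ← hx.2]
      ext b; simp only [mem_filter, mem_inter]
      exact ⟨fun h => ⟨⟨hB h.1, h.2⟩, h.1⟩, fun h => ⟨h.2, h.1.2⟩⟩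
  have hlow : ∀ A ∈ P.powersetCard m, (#X - c * (m + 1)) * D ≤ 2 * ∑ a ∈ P \ A, f A a := by
    intro A hA
    rw [mem_powersetCard] at hA
    have hclass : ∀ t ∈ A.powerset, (traceCount r X A t - 1) * D ≤
        2 * ∑ a ∈ P \ A, min (traceCount r X (insert a A) t)
          (traceCount r X (insert a A) (insert a t)) := by
      intro t ht
      rw [mem_powerset] at ht
      refine (card_sub_one_mul_le_sum_min r {x ∈ X | A.filter (r x) = t} (P \ A) D ?_).trans ?_
      · intro x hx y hy hxy
        rw [mem_filter] at hx hy
        refine (hD x hx.1 y hy.1 hxy).trans (card_le_card fun p hp => ?_)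
        rw [mem_filter] at hp ⊢
        refine ⟨mem_sdiff.2 ⟨hp.1, fun hpA => hp.2 ?_⟩, hp.2⟩
        have := congrArg (p ∈ ·) (hx.2.trans hy.2.symm)
        simpa [hpA] using this
      · refine Nat.mul_le_mul_left _ (sum_le_sum fun a ha => ?_)
        have haA := (mem_sdiff.1 ha).2
        have hat : a ∉ t := fun h => haA (ht h)
        refine min_le_min (card_le_card fun x hx => ?_) (card_le_card fun x hx => ?_)
        · simp only [mem_filter] at hx ⊢
          exact ⟨hx.1.1, by rw [filter_insert, if_neg hx.2, hx.1.2]⟩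
        · simp only [mem_filter] at hx ⊢
          exact ⟨hx.1.1, by rw [filter_insert, if_pos hx.2, hx.1.2]⟩
    have himg : ∀ g : Finset β → ℕ, (∀ t, traceCount r X A t = 0 → g t = 0) →
        ∑ t ∈ A.powerset, g t = ∑ t ∈ X.image (fun x => A.filter (r x)), g t := by
      intro g hg
      refine (sum_subset (fun t ht => ?_) fun t _ ht => hg t ?_).symm
      · obtain ⟨x, _, rfl⟩ := mem_image.1 ht
        exact mem_powerset.2 (filter_subset _ _)
      · rw [traceCount, card_eq_zero, filter_eq_empty_iff]
        exact fun x hx h => ht (mem_image.2 ⟨x, hx, h⟩)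
    calc (#X - c * (m + 1)) * D
        ≤ (∑ t ∈ A.powerset, (traceCount r X A t - 1)) * D := by
          refine Nat.mul_le_mul_right _ ?_
          have h₁ := sum_traceCount r X A
          rw [himg _ (fun t ht => ht)] at h₁
          rw [himg _ (fun t ht => by rw [ht])]
          have h₂ := htr A hA.1
          rw [hA.2] at h₂
          have h₃ : ∑ t ∈ X.image (fun x => A.filter (r x)), traceCount r X A t ≤
              ∑ t ∈ X.image (fun x => A.filter (r x)), (traceCount r X A t - 1) +
              ∑ t ∈ X.image (fun x => A.filter (r x)), 1 := by
            rw [← sum_add_distrib]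
            exact sum_le_sum fun t _ => by omega
          rw [sum_const, smul_eq_mul, mul_one] at h₃
          omega
      _ ≤ ∑ t ∈ A.powerset, 2 * ∑ a ∈ P \ A, min (traceCount r X (insert a A) t)
          (traceCount r X (insert a A) (insert a t)) := by
          rw [sum_mul]; exact sum_le_sum hclass
      _ = 2 * ∑ a ∈ P \ A, f A a := by rw [← mul_sum, sum_comm]
  have hmain : (#P).choose m * ((#X - c * (m + 1)) * D) ≤
      2 * ((#P).choose (m + 1) * (d * #X)) := by
    have h₁ := sum_le_sum hlow
    have h₂ := sum_le_sum hup
    rw [sum_const, card_powersetCard, smul_eq_mul, ← mul_sum] at h₁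
    rw [sum_const, card_powersetCard, smul_eq_mul, sum_powersetCard_succ] at h₂
    omega
  have hchoose : (#P).choose (m + 1) * (m + 1) ≤ (#P).choose m * #P := by
    rw [Nat.choose_succ_right_eq]; exact Nat.mul_le_mul_left _ (Nat.sub_le _ _)
  have hpos : 0 < (#P).choose m := Nat.choose_pos (by omega)
  have h₁ : (m + 1) * ((#X - c * (m + 1)) * D) ≤ 2 * (#P * (d * #X)) := by
    refine Nat.le_of_mul_le_mul_left ?_ hpos
    calc (#P).choose m * ((m + 1) * ((#X - c * (m + 1)) * D))
        = (m + 1) * ((#P).choose m * ((#X - c * (m + 1)) * D)) := by ring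
      _ ≤ (m + 1) * (2 * ((#P).choose (m + 1) * (d * #X))) := Nat.mul_le_mul_left _ hmain
      _ = 2 * (((#P).choose (m + 1) * (m + 1)) * (d * #X)) := by ring
      _ ≤ 2 * (((#P).choose m * #P) * (d * #X)) := by gcongr
      _ = _ := by ring
  have h₂ : #X ≤ 2 * (#X - c * (m + 1)) := by
    have : 2 * c * (m + 1) = 2 * (c * (m + 1)) := by ring
    omega
  have h₃ : (m + 1) * (#X * D) ≤ (m + 1) * (#X * (16 * c ^ 2 * d)) := by
    calc (m + 1) * (#X * D) ≤ (m + 1) * ((2 * (#X - c * (m + 1))) * D) := by gcongr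
      _ = 2 * ((m + 1) * ((#X - c * (m + 1)) * D)) := by ring
      _ ≤ 2 * (2 * (#P * (d * #X))) := by gcongr
      _ ≤ 2 * (2 * ((c * (4 * c * (m + 1))) * (d * #X))) := by
        gcongr; exact hP.trans (Nat.mul_le_mul_left _ hm₂)
      _ = _ := by ring
  have h₄ := Nat.le_of_mul_le_mul_left (Nat.le_of_mul_le_mul_left h₃ (by omega)) (by omega)
  omega

end NearTwins

/-! ### Stability: trees, half-graphs and walks -/

section Stability

variable {α β : Type*} (r : α → β → Prop)

/-- There is a complete binary tree of depth `n` whose inner nodes are labelled by elements of `J` and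
whose leaves are labelled by elements of `I`, such that a leaf `i` lies in the left subtree of an inner
node `j` above it if and only if `r i j` holds.  Its existence for all `n` means that the Littlestone
dimension is infinite. -/
def HasTree : ℕ → Set β → Set α → Prop
  | 0, _, I => I.Nonempty
  | n + 1, J, I => ∃ j ∈ J, HasTree n J {i ∈ I | r i j} ∧ HasTree n J {i ∈ I | ¬ r i j}

variable {r}

theorem HasTree.mono {n : ℕ} {J J' : Set β} {I I' : Set α} (h : HasTree r n J I) (hJ : J ⊆ J')
    (hI : I ⊆ I') : HasTree r n J' I' := by
  induction n generalizing I I' with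
  | zero => exact Set.Nonempty.mono hI h
  | succ n ih =>
    obtain ⟨j, hj, h₁, h₂⟩ := h
    exact ⟨j, hJ hj, ih h₁ fun i hi => ⟨hI hi.1, hi.2⟩, ih h₂ fun i hi => ⟨hI hi.1, hi.2⟩⟩

theorem HasTree.nonempty {n : ℕ} {J : Set β} {I : Set α} (h : HasTree r n J I) : I.Nonempty := by
  induction n generalizing I with
  | zero => exact h
  | succ n ih =>
    obtain ⟨j, _, h₁, _⟩ := h
    exact (ih h₁).mono fun i hi => hi.1

/-- The Ramsey property of trees for colorings of the inner nodes with two colors. -/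
theorem HasTree.split {J J₁ J₂ : Set β} (hJ : J ⊆ J₁ ∪ J₂) (n : ℕ) : ∀ {a b : ℕ} {I : Set α},
    a + b = n → HasTree r n J I → HasTree r a J₁ I ∨ HasTree r b J₂ I := by
  induction n with
  | zero =>
    intro a b I hab h
    obtain rfl : a = 0 := by omega
    exact Or.inl h
  | succ n ih =>
    intro a b I hab h
    rcases Nat.eq_zero_or_pos a with rfl | ha
    · exact Or.inl h.nonempty
    rcases Nat.eq_zero_or_pos b with rfl | hb
    · exact Or.inr h.nonempty
    obtain ⟨j, hj, h₁, h₂⟩ := h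
    rcases hJ hj with hj | hj
    · obtain ⟨a, rfl⟩ : ∃ a', a = a' + 1 := ⟨a - 1, by omega⟩
      rcases ih (a := a) (b := b) (by omega) h₁ with h₁ | h₁
      · rcases ih (a := a) (b := b) (by omega) h₂ with h₂ | h₂
        · exact Or.inl ⟨j, hj, h₁, h₂⟩
        · exact Or.inr (h₂.mono subset_rfl fun i hi => hi.1)
      · exact Or.inr (h₁.mono subset_rfl fun i hi => hi.1)
    · obtain ⟨b, rfl⟩ : ∃ b', b = b' + 1 := ⟨b - 1, by omega⟩
      rcases ih (a := a) (b := b) (by omega) h₁ with h₁ | h₁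
      · exact Or.inl (h₁.mono subset_rfl fun i hi => hi.1)
      · rcases ih (a := a) (b := b) (by omega) h₂ with h₂ | h₂
        · exact Or.inl (h₂.mono subset_rfl fun i hi => hi.1)
        · exact Or.inr ⟨j, hj, h₁, h₂⟩

/-- A depth of trees that guarantees ladders of lengths `p`, `q` with `p + q = n`. -/
def treeDepth : ℕ → ℕ
  | 0 => 0
  | n + 1 => (treeDepth n + 1) + (treeDepth n + 1)

/-- A deep tree yields a half-graph.  In each step, some leaf `i` is fixed, and the tree is restricted to
nodes that agree on `i`; then the root `j` of the new tree is fixed, and the tree is restricted to that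
subtree of it which disagrees with `i` on `j`. -/
theorem HasTree.exists_ladder (n : ℕ) : ∀ {p q : ℕ} {J : Set β} {I : Set α}, p + q = n →
    HasTree r (treeDepth n) J I →
    (∃ (x : Fin p → α) (y : Fin p → β), (∀ a, x a ∈ I) ∧ (∀ a, y a ∈ J) ∧
      ∀ a b, r (x a) (y b) ↔ a ≤ b) ∨
    (∃ (x : Fin q → α) (y : Fin q → β), (∀ a, x a ∈ I) ∧ (∀ a, y a ∈ J) ∧
      ∀ a b, r (x a) (y b) ↔ b < a) := by
  induction n with
  | zero =>
    intro p q J I hpq h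
    obtain rfl : p = 0 := by omega
    exact Or.inl ⟨Fin.elim0, Fin.elim0, fun a => a.elim0, fun a => a.elim0, fun a => a.elim0⟩
  | succ n ih =>
    intro p q J I hpq h
    rcases Nat.eq_zero_or_pos p with rfl | hp
    · exact Or.inl ⟨Fin.elim0, Fin.elim0, fun a => a.elim0, fun a => a.elim0, fun a => a.elim0⟩
    rcases Nat.eq_zero_or_pos q with rfl | hq
    · exact Or.inr ⟨Fin.elim0, Fin.elim0, fun a => a.elim0, fun a => a.elim0, fun a => a.elim0⟩
    obtain ⟨i, hi⟩ := h.nonempty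
    have hJ : J ⊆ {j ∈ J | r i j} ∪ {j ∈ J | ¬ r i j} := fun j hj => by
      by_cases hr : r i j
      · exact Or.inl ⟨hj, hr⟩
      · exact Or.inr ⟨hj, hr⟩
    rcases h.split hJ _ rfl with ⟨j, hj, _, h'⟩ | ⟨j, hj, h', _⟩
    · obtain ⟨p, rfl⟩ : ∃ p', p = p' + 1 := ⟨p - 1, by omega⟩
      rcases ih (p := p) (q := q) (by omega) h' with ⟨x, y, hx, hy, hxy⟩ | ⟨x, y, hx, hy, hxy⟩
      · refine Or.inl ⟨Fin.cons i x, Fin.cons j y, ?_, ?_, ?_⟩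
        · exact Fin.cases hi fun a => (hx a).1
        · exact Fin.cases hj.1 fun a => (hy a).1
        · refine Fin.cases (Fin.cases ?_ fun b => ?_) fun a => Fin.cases ?_ fun b => ?_
          · simpa using hj.2
          · simpa using (hy b).2
          · simpa using (hx a).2
          · simpa using hxy a b
      · exact Or.inr ⟨x, y, fun a => (hx a).1, fun a => (hy a).1, hxy⟩
    · obtain ⟨q, rfl⟩ : ∃ q', q = q' + 1 := ⟨q - 1, by omega⟩
      rcases ih (p := p) (q := q) (by omega) h' with ⟨x, y, hx, hy, hxy⟩ | ⟨x, y, hx, hy, hxy⟩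
      · exact Or.inl ⟨x, y, fun a => (hx a).1, fun a => (hy a).1, hxy⟩
      · refine Or.inr ⟨Fin.cons i x, Fin.cons j y, ?_, ?_, ?_⟩
        · exact Fin.cases hi fun a => (hx a).1
        · exact Fin.cases hj.1 fun a => (hy a).1
        · refine Fin.cases (Fin.cases ?_ fun b => ?_) fun a => Fin.cases ?_ fun b => ?_
          · simpa using hj.2
          · simpa using (hy b).2
          · simpa using (hx a).2
          · simpa using hxy a b

/-- There is no half-graph of order `h` between two sequences. -/
def NoHalfGraph (r : α → β → Prop) (h : ℕ) : Prop :=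
  ¬ ∃ (x : Fin h → α) (y : Fin h → β), ∀ a b, r (x a) (y b) ↔ a ≤ b

theorem NoHalfGraph.not_hasTree {h : ℕ} (hr : NoHalfGraph r h) (J : Set β) (I : Set α) :
    ¬ HasTree r (treeDepth (h + (h + 1))) J I := by
  intro ht
  rcases ht.exists_ladder _ rfl with ⟨x, y, -, -, hxy⟩ | ⟨x, y, -, -, hxy⟩
  · exact hr ⟨x, y, hxy⟩
  · -- reversing the order and shifting by one turns `b < a` into `a ≤ b`
    refine hr ⟨fun a => x a.rev.succ, fun b => y b.rev.castSucc, fun a b => ?_⟩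
    rw [hxy, Fin.castSucc_lt_succ_iff, Fin.rev_le_rev]

/-- The number of elements for which a walk with steps of size at most `δ` gives rise to a tree of depth
`n`. -/
def walkBound (δ : ℕ) : ℕ → ℕ
  | 0 => 1
  | n + 1 => 2 * (walkBound δ n + δ)

variable [DecidableEq α] [∀ i j, Decidable (r i j)]

/-- Let the sets `{i ∈ I | r i (q k)}` lead from `I` to the empty set in steps that change at most
`δ` elements.  Such a walk passes through a set of about half the size of `I`.  This set is the root of
a tree: the rest of the walk leads from this set to the empty set, and the walk up to this point leads
from its complement to the empty set when restricted to the complement. -/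
theorem hasTree_of_walk (δ : ℕ) (q : ℕ → β) (n : ℕ) : ∀ (I : Finset α) (s t : ℕ), s ≤ t →
    walkBound δ n ≤ #I → (∀ i ∈ I, r i (q s)) → (∀ i ∈ I, ¬ r i (q t)) →
    (∀ k, #{i ∈ I | ¬(r i (q k) ↔ r i (q (k + 1)))} ≤ δ) →
    HasTree r n Set.univ (I : Set α) := by
  induction n with
  | zero =>
    intro I s t _ hI _ _ _
    exact card_pos.1 hI
  | succ n ih =>
    intro I s t hst hI hs ht hstep
    rw [walkBound] at hI
    have hex : ∃ k, s ≤ k ∧ 2 * #{i ∈ I | r i (q k)} ≤ #I :=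
      ⟨t, hst, by rw [filter_eq_empty_iff.2 ht]; simp⟩
    classical
    obtain ⟨hk₁, hk₂⟩ := Nat.find_spec hex
    have hkt : Nat.find hex ≤ t :=
      Nat.find_min' hex ⟨hst, by rw [filter_eq_empty_iff.2 ht]; simp⟩
    have hmin : ∀ k' < Nat.find hex, s ≤ k' → #I < 2 * #{i ∈ I | r i (q k')} := fun k' hk' hsk => by
      by_contra! h
      exact Nat.find_min hex hk' ⟨hsk, h⟩
    generalize Nat.find hex = k at hk₁ hk₂ hkt hmin
    have hpart := card_filter_add_card_filter_not (s := I) (fun i => r i (q k))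
    rcases Nat.eq_or_lt_of_le hk₁ with rfl | hlt
    · rw [filter_true_of_mem hs] at hk₂
      have : 1 ≤ walkBound δ n := by
        cases n <;> simp [walkBound]
        rename_i n
        have : 1 ≤ walkBound δ n := by
          clear * -
          induction n with
          | zero => simp [walkBound]
          | succ n ih => simp only [walkBound]; omega
        omega
      omega
    obtain ⟨k, rfl⟩ : ∃ k', k = k' + 1 := ⟨k - 1, by omega⟩
    have h₁ := hmin k (by omega) (by omega)
    have h₂ : #{i ∈ I | r i (q k)} ≤ #{i ∈ I | r i (q (k + 1))} + δ := by
      refine le_trans ?_ (Nat.add_le_add_left (hstep k) _)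
      refine (card_le_card fun i hi => ?_).trans (card_union_le _ _)
      simp only [mem_union, mem_filter] at hi ⊢
      tauto
    have hsub : ∀ (p : α → Prop) [DecidablePred p] (k : ℕ),
        #{i ∈ I.filter p | ¬(r i (q k) ↔ r i (q (k + 1)))} ≤ δ := fun p _ k =>
      (card_le_card (filter_subset_filter _ (filter_subset _ _))).trans (hstep k)
    refine ⟨q (k + 1), Set.mem_univ _, ?_, ?_⟩
    · have := ih (I.filter fun i => r i (q (k + 1))) (k + 1) t hkt (by omega)
        (fun i hi => (mem_filter.1 hi).2) (fun i hi => ht i (mem_filter.1 hi).1) (hsub _)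
      simpa using this
    · have := ih (I.filter fun i => ¬ r i (q (k + 1))) s (k + 1) (by omega) (by omega)
        (fun i hi => hs i (mem_filter.1 hi).1) (fun i hi => (mem_filter.1 hi).2) (hsub _)
      simpa using this

end Stability

/-! ### Orders by near-twins -/

section Elimination

variable {V : Type*} [DecidableEq V] (r : V → V → Prop) [∀ x, DecidablePred (r x)]

/-- Let the vertices be ordered by `τ`, such that each vertex `v` but the first has a predecessor `p v`
that is a near-twin of `v`: the set `F` represents the traces of all neighborhoods `r w` on the vertices
up to `v`, and at most `δ` of them separate `v` from `p v`.  Let `c w` be the first vertex of `r w`.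
Then there are boundedly many centers `c w` of the neighborhoods `r w` that contain a given vertex `v`.

To see this, follow the walk `v`, `p v`, `p (p v)`, … down to the first vertex.  The neighborhoods `r w`
in question have different centers, hence different traces, as long as these are not empty.  So the set
of those `w` for which `r w` contains the current vertex of the walk changes by at most `δ` elements in
each step, and it leads from everything to almost nothing. -/
theorem card_image_center_le [Fintype V] {h δ : ℕ} (hh : NoHalfGraph r h)
    (τ : V → ℕ) (hτ : Function.Injective τ) (p : V → V)
    (hp : ∀ v, (∀ x, τ v ≤ τ x) ∨ τ (p v) < τ v ∧ ∃ F : Finset V,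
      (∀ w, ∃ w' ∈ F, ∀ x, τ x ≤ τ v → (r w x ↔ r w' x)) ∧
      #{w ∈ F | ¬(r w v ↔ r w (p v))} ≤ δ)
    (c : V → V) (hc : ∀ w, r w (c w)) (hc' : ∀ w x, r w x → τ (c w) ≤ τ x) (v : V) :
    #(Finset.image c {w | r w v}) ≤ walkBound δ (treeDepth (h + (h + 1))) := by
  obtain ⟨W, hWv, hWinj, hWimg⟩ : ∃ W : Finset V, (∀ w ∈ W, r w v) ∧ Set.InjOn c W ∧
      W.image c = Finset.image c {w | r w v} := by
    obtain ⟨W, hW, hinj⟩ := Set.exists_subset_bijOn ({w | r w v} : Set V) c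
    lift W to Finset V using W.toFinite
    refine ⟨W, fun w hw => hW hw, hinj.injOn, ?_⟩
    rw [← coe_inj]
    simpa using hinj.image_eq
  rw [← hWimg, card_image_of_injOn hWinj]
  by_contra! hlt
  -- `root` is the first vertex; at most one `w ∈ W` has it as its center
  obtain ⟨root, hroot⟩ : ∃ x₀, ∀ x, τ x₀ ≤ τ x := by
    obtain ⟨x₀, _, h₀⟩ := exists_min_image univ τ ⟨v, mem_univ v⟩
    exact ⟨x₀, fun x => h₀ x (mem_univ x)⟩
  have hcroot : ∀ w, r w root → c w = root := fun w hw =>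
    hτ (le_antisymm (hc' w root hw) (hroot _))
  set I := W.filter fun w => ¬ r w root with hI
  have hIW : I ⊆ W := filter_subset _ _
  have hIcard : walkBound δ (treeDepth (h + (h + 1))) ≤ #I := by
    have h₁ : #{w ∈ W | r w root} ≤ 1 := card_le_one.2 fun a ha b hb => by
      rw [mem_filter] at ha hb
      exact hWinj ha.1 hb.1 ((hcroot a ha.2).trans (hcroot b hb.2).symm)
    have h₂ : #{w ∈ W | r w root} + #I = #W := card_filter_add_card_filter_not _
    omega
  set p' : V → V := fun x => if x = root then root else p x with hp'
  have hstep : ∀ x, #{w ∈ I | ¬(r w x ↔ r w (p' x))} ≤ δ := by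
    intro x
    by_cases hx : x = root
    · simp [hp', hx]
    simp only [hp', if_neg hx]
    rcases hp x with h₀ | ⟨hlt, F, hF, hFδ⟩
    · exact absurd (hτ (le_antisymm (h₀ root) (hroot x))) hx
    choose g hgF hg using hF
    refine le_trans (card_le_card_of_injOn g ?_ ?_) hFδ
    · intro w hw
      have hw := (mem_filter.1 (mem_coe.1 hw)).2
      refine mem_coe.2 (mem_filter.2 ⟨hgF w, ?_⟩)
      rwa [← hg w x le_rfl, ← hg w (p x) hlt.le]
    · -- separated vertices with the same trace on the vertices up to `x` have the same center
      have key : ∀ w w', ¬(r w x ↔ r w (p x)) → g w = g w' → τ (c w') ≤ τ (c w) := by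
        intro w w' hw hgg
        have hcx : τ (c w) ≤ τ x := by
          by_cases hwx : r w x
          · exact hc' w x hwx
          · exact (hc' w (p x) (by tauto)).trans hlt.le
        refine hc' w' _ ?_
        rw [hg w' _ hcx, ← hgg, ← hg w _ hcx]
        exact hc w
      intro w hw w' hw' hgg
      have hw := mem_filter.1 (mem_coe.1 hw)
      have hw' := mem_filter.1 (mem_coe.1 hw')
      exact hWinj (hIW hw.1) (hIW hw'.1)
        (hτ (le_antisymm (key w' w hw'.2 hgg.symm) (key w w' hw.2 hgg)))
  have hdesc : ∀ k, p'^[k] v = root ∨ τ (p'^[k] v) + k ≤ τ v := by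
    intro k
    induction k with
    | zero => right; simp
    | succ k ih =>
      rw [Function.iterate_succ_apply']
      by_cases hx : p'^[k] v = root
      · left; rw [hx]; simp [hp']
      · right
        rcases hp (p'^[k] v) with h₀ | ⟨hlt, -⟩
        · exact absurd (hτ (le_antisymm (h₀ root) (hroot _))) hx
        · have := ih.resolve_left hx
          have hpx : p' (p'^[k] v) = p (p'^[k] v) := if_neg hx
          rw [hpx]
          omega
  have hend : p'^[τ v + 1] v = root := (hdesc _).resolve_right (by omega)
  refine hh.not_hasTree Set.univ (I : Set V) (hasTree_of_walk δ (fun k => p'^[k] v) _ I 0 (τ v + 1)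
    (Nat.zero_le _) hIcard (fun w hw => hWv w (hIW hw)) (fun w hw => ?_) fun k => ?_)
  · rw [hend]; exact (mem_filter.1 hw).2
  · simp only [Function.iterate_succ_apply']
    exact hstep _

/-- The relation `r` induces at most `c * (|S| + 1)` traces on every set `S`. -/
def LinearTraces (r : V → V → Prop) [∀ x, DecidablePred (r x)] [Fintype V] (c : ℕ) : Prop :=
  ∀ S : Finset V, #(univ.image fun x => S.filter (r x)) ≤ c * (#S + 1)

/-- The number of representatives that may separate near-twins. -/
def twinBound (c : ℕ) : ℕ := 16 * (2 * c) ^ 2 * (2 * c) + 2 * (2 * c) ^ 2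

variable {r}

theorem LinearTraces.card_le_of_shattered [Fintype V] {c : ℕ} (hr : LinearTraces r c) (B : Finset V)
    (hB : ∀ t ⊆ B, ∃ x, B.filter (r x) = t) : #B ≤ 2 * c := by
  have h₁ : 2 ^ #B ≤ c * (#B + 1) := by
    rw [← card_powerset]
    refine (card_le_card fun t ht => ?_).trans (hr B)
    obtain ⟨x, hx⟩ := hB t (mem_powerset.1 ht)
    exact mem_image.2 ⟨x, mem_univ _, hx⟩
  have h₂ : ∀ k : ℕ, k * (k + 1) ≤ 2 * 2 ^ k := by
    intro k
    induction k with
    | zero => simp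
    | succ k ih =>
      have : k + 1 ≤ 2 ^ k := Nat.lt_two_pow_self
      rw [pow_succ]
      nlinarith
  refine Nat.le_of_mul_le_mul_right (c := #B + 1) ?_ (Nat.succ_pos _)
  have := h₂ #B
  nlinarith

/-- Among at least two vertices of `S`, there are near-twins with respect to representatives `F` of the
traces on `S`. -/
theorem LinearTraces.exists_near_twins [Fintype V] {c : ℕ} (hr : LinearTraces r c)
    (S F : Finset V) (hS : 2 ≤ #S)
    (hF : ∀ w ∈ F, ∀ w' ∈ F, (∀ x ∈ S, r w x ↔ r w' x) → w = w') :
    ∃ x ∈ S, ∃ y ∈ S, x ≠ y ∧ #{w ∈ F | ¬(r x w ↔ r y w)} ≤ twinBound c := by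
  refine CompactCovers.exists_near_twins r S F (2 * c) (2 * c) hS ?_ (fun A _ => ?_) fun B _ hB => ?_
  · have h₁ : #F ≤ c * (#S + 1) := by
      rw [← card_image_of_injOn (s := F) (f := fun x => S.filter (r x))]
      · exact (card_le_card (image_subset_image (subset_univ _))).trans (hr S)
      · intro w hw w' hw' h
        refine hF w hw w' hw' fun x hx => ?_
        have := congrArg (x ∈ ·) h
        simpa [hx] using this
    nlinarith
  · have h₁ := (card_le_card (image_subset_image (f := fun x => A.filter (r x))
      (subset_univ S))).trans (hr A)
    nlinarith
  · exact hr.card_le_of_shattered B fun t ht => (hB t ht).imp fun x hx => hx.2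

end Elimination

/-! ### Verification of programs for the random access machine -/

/-- Arithmetic expressions over registers and memory cells. -/
inductive Expr
  | var (r : ℕ) : Expr
  | lit (v : ℕ) : Expr
  | add (a b : Expr) : Expr
  | sub (a b : Expr) : Expr
  | mul (a b : Expr) : Expr
  | mem (a : Expr) : Expr

namespace Expr

/-- The program that computes the value of an expression in register `t`, with the registers above
`t` as a stack of intermediate results. -/
def compile : Expr → ℕ → RamProg
  | var r, t => .seq (.const t 0) (.add t r t)
  | lit v, t => .const t v
  | add a b, t => .seq (compile a t) (.seq (compile b (t + 1)) (.add t t (t + 1)))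
  | sub a b, t => .seq (compile a t) (.seq (compile b (t + 1)) (.sub t t (t + 1)))
  | mul a b, t => .seq (compile a t) (.seq (compile b (t + 1)) (.mul t t (t + 1)))
  | mem a, t => .seq (compile a t) (.load t t)

/-- The running time of the compiled expression. -/
def cost : Expr → ℕ
  | var _ => 2
  | lit _ => 1
  | add a b => cost a + (cost b + 1)
  | sub a b => cost a + (cost b + 1)
  | mul a b => cost a + (cost b + 1)
  | mem a => cost a + 1

/-- In the state `s`, the expression has the given value, mentions only registers below `20`, and
all intermediate results are below `W`. -/
inductive Evals (W : ℕ) (s : RamState) : Expr → ℕ → Prop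
  | var (r : ℕ) (hr : r < 20) (h : s.reg r < W) : Evals W s (var r) (s.reg r)
  | lit (v : ℕ) (h : v < W) : Evals W s (lit v) v
  | add {a b : Expr} {x y : ℕ} (ha : Evals W s a x) (hb : Evals W s b y) (h : x + y < W) :
      Evals W s (add a b) (x + y)
  | sub {a b : Expr} {x y : ℕ} (ha : Evals W s a x) (hb : Evals W s b y) :
      Evals W s (sub a b) (x - y)
  | mul {a b : Expr} {x y : ℕ} (ha : Evals W s a x) (hb : Evals W s b y) (h : x * y < W) :
      Evals W s (mul a b) (x * y)
  | mem {a : Expr} {x : ℕ} (ha : Evals W s a x) (h : s.mem x < W) : Evals W s (mem a) (s.mem x)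

end Expr

/-- Two states agree on the memory and on the registers below `20`, which hold the variables of a
program; the other registers hold intermediate results. -/
def Agree (s s' : RamState) : Prop := s.mem = s'.mem ∧ ∀ r < 20, s.reg r = s'.reg r

namespace Agree

theorem refl (s : RamState) : Agree s s := ⟨rfl, fun _ _ => rfl⟩

theorem setMem {s s' : RamState} (h : Agree s s') (a v : ℕ) :
    Agree (s.setMem a v) (s'.setMem a v) := by
  refine ⟨?_, h.2⟩
  simp [RamState.setMem, h.1]

end Agree

theorem Expr.Evals.lt {W : ℕ} {s : RamState} {e : Expr} {v : ℕ} (h : e.Evals W s v) : v < W := by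
  induction h with
  | sub _ _ iha _ => omega
  | _ => assumption

/-- The compiled expression leaves the registers below `t` untouched. -/
theorem Expr.Evals.exec {W : ℕ} {s : RamState} {e : Expr} {v : ℕ} (h : e.Evals W s v) :
    ∀ (t : ℕ), 20 ≤ t → ∀ s₀, Agree s₀ s →
    ∃ s₁, RamExec W (e.compile t) s₀ e.cost s₁ ∧ s₁.mem = s₀.mem ∧ s₁.reg t = v ∧
      ∀ r < t, s₁.reg r = s₀.reg r := by
  have binary : ∀ {a b : Expr} {x y : ℕ}
      (_ : ∀ (t : ℕ), 20 ≤ t → ∀ s₀, Agree s₀ s →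
        ∃ s₁, RamExec W (a.compile t) s₀ a.cost s₁ ∧ s₁.mem = s₀.mem ∧ s₁.reg t = x ∧
          ∀ r < t, s₁.reg r = s₀.reg r)
      (_ : ∀ (t : ℕ), 20 ≤ t → ∀ s₀, Agree s₀ s →
        ∃ s₁, RamExec W (b.compile t) s₀ b.cost s₁ ∧ s₁.mem = s₀.mem ∧ s₁.reg t = y ∧
          ∀ r < t, s₁.reg r = s₀.reg r)
      (op : ℕ → ℕ → ℕ → RamProg) (v : ℕ)
      (_ : ∀ t s', s'.reg t = x → s'.reg (t + 1) = y →
        RamExec W (op t t (t + 1)) s' 1 (s'.setReg t v))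
      (t : ℕ), 20 ≤ t → ∀ s₀, Agree s₀ s →
      ∃ s₁, RamExec W (.seq (a.compile t) (.seq (b.compile (t + 1)) (op t t (t + 1)))) s₀
        (a.cost + (b.cost + 1)) s₁ ∧ s₁.mem = s₀.mem ∧ s₁.reg t = v ∧
          ∀ r < t, s₁.reg r = s₀.reg r := by
    intro a b x y iha ihb op v hop t ht s₀ hs₀
    obtain ⟨s₁, e₁, m₁, v₁, f₁⟩ := iha t ht s₀ hs₀
    obtain ⟨s₂, e₂, m₂, v₂, f₂⟩ := ihb (t + 1) (by omega) s₁
      ⟨m₁.trans hs₀.1, fun r hr => (f₁ r (by omega)).trans (hs₀.2 r hr)⟩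
    refine ⟨s₂.setReg t v, .seq e₁ (.seq e₂ (hop t s₂ ?_ v₂)), m₂.trans m₁, ?_, fun r hr => ?_⟩
    · rw [f₂ t (by omega), v₁]
    · simp [RamState.setReg]
    · rw [← f₁ r hr, ← f₂ r (by omega)]
      simp [RamState.setReg, show r ≠ t by omega]
  induction h with
  | var r hr h =>
    intro t ht s₀ hs₀
    refine ⟨_, .seq (.const _ _ _ (by omega)) (.add _ _ _ _ ?_), rfl, ?_, fun r' hr' => ?_⟩
    · simpa [RamState.setReg, show r ≠ t by omega, hs₀.2 r hr] using h
    · simp [RamState.setReg, show r ≠ t by omega, hs₀.2 r hr]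
    · simp [RamState.setReg, show r' ≠ t by omega]
  | lit v h =>
    intro t ht s₀ hs₀
    refine ⟨_, .const _ _ _ h, rfl, ?_, fun r' hr' => ?_⟩
    · simp [RamState.setReg]
    · simp [RamState.setReg, show r' ≠ t by omega]
  | @add a b x y _ _ h iha ihb =>
    exact binary iha ihb .add _ fun t s' h₁ h₂ => by
      subst h₁ h₂; exact .add _ _ _ _ h
  | @sub a b x y ha _ iha ihb =>
    exact binary iha ihb .sub _ fun t s' h₁ h₂ => by
      subst h₁ h₂; exact .sub _ _ _ _ (lt_of_le_of_lt (Nat.sub_le _ _) ha.lt)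
  | @mul a b x y _ _ h iha ihb =>
    exact binary iha ihb .mul _ fun t s' h₁ h₂ => by
      subst h₁ h₂; exact .mul _ _ _ _ h
  | mem _ h iha =>
    intro t ht s₀ hs₀
    obtain ⟨s₁, e₁, m₁, rfl, f₁⟩ := iha t ht s₀ hs₀
    have hm : s₁.mem = s.mem := m₁.trans hs₀.1
    refine ⟨_, .seq e₁ (.load _ _ _ (by rwa [hm])), m₁, ?_, fun r' hr' => ?_⟩
    · simp [RamState.setReg, hm]
    · simp [RamState.setReg, show r' ≠ t by omega, f₁ r' hr']

/-- Total correctness with a time bound: from the state `s`, the program halts within `T` steps in a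
state with the property `Q`.  States are taken up to agreement on memory and variables, so that
intermediate results may be ignored. -/
def Runs (W : ℕ) (p : RamProg) (s : RamState) (T : ℕ) (Q : RamState → Prop) : Prop :=
  ∀ s₀, Agree s₀ s → ∃ t s₁ s', RamExec W p s₀ t s₁ ∧ t ≤ T ∧ Agree s₁ s' ∧ Q s'

/-- Assign the value of an expression to a variable. -/
def assign (x : ℕ) (e : Expr) : RamProg := .seq (e.compile 20) (.seq (.const 21 0) (.add x 20 21))

/-- Store the value of an expression in the memory cell whose address is given by another. -/
def storeAt (a e : Expr) : RamProg := .seq (a.compile 20) (.seq (e.compile 21) (.store 20 21))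

/-- Run a program if the value of an expression is not zero. -/
def ifNonzero (e : Expr) (p : RamProg) : RamProg := .seq (e.compile 20) (.ite 20 p .skip)

/-- Run a program for the values `0, …, b - 1` of the variable `i`, where `b` is a variable. -/
def forLoop (i b : ℕ) (p : RamProg) : RamProg :=
  .seq (assign i (.lit 0)) (.seq (Expr.compile (.sub (.var b) (.var i)) 20)
    (.loop 20 (.seq p (.seq (assign i (.add (.var i) (.lit 1)))
      (Expr.compile (.sub (.var b) (.var i)) 20)))))

namespace Runs

variable {W : ℕ} {s : RamState} {Q : RamState → Prop}

theorem mono {p : RamProg} {T T' : ℕ} {Q' : RamState → Prop} (h : Runs W p s T Q) (hT : T ≤ T')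
    (hQ : ∀ s', Q s' → Q' s') : Runs W p s T' Q' := fun s₀ hs₀ => by
  obtain ⟨t, s₁, s', e, ht, ha, hq⟩ := h s₀ hs₀
  exact ⟨t, s₁, s', e, ht.trans hT, ha, hQ _ hq⟩

theorem seq {p q : RamProg} {T T' : ℕ} {Q' : RamState → Prop} (h : Runs W p s T Q')
    (h' : ∀ s', Q' s' → Runs W q s' T' Q) : Runs W (.seq p q) s (T + T') Q := fun s₀ hs₀ => by
  obtain ⟨t, s₁, s', e, ht, ha, hq⟩ := h s₀ hs₀
  obtain ⟨t', s₂, s'', e', ht', ha', hq'⟩ := h' s' hq s₁ ha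
  exact ⟨_, s₂, s'', .seq e e', by omega, ha', hq'⟩

theorem assign {x v : ℕ} {e : Expr} (he : e.Evals W s v) (hx : x < 20) (hQ : Q (s.setReg x v)) :
    Runs W (assign x e) s (e.cost + 2) Q := fun s₀ hs₀ => by
  obtain ⟨s₁, e₁, m₁, v₁, f₁⟩ := he.exec 20 le_rfl s₀ hs₀
  have hv := he.lt
  refine ⟨_, _, _, .seq e₁ (.seq (.const _ _ _ (by omega)) (.add _ _ _ _ ?_)), le_rfl, ?_, hQ⟩
  · simpa [RamState.setReg, v₁] using hv
  · refine ⟨m₁.trans hs₀.1, fun r hr => ?_⟩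
    by_cases hrx : r = x
    · subst hrx; simp [RamState.setReg, v₁]
    · simp [RamState.setReg, hrx, show r ≠ 21 by omega, f₁ r hr, hs₀.2 r hr]

theorem storeAt {x v : ℕ} {a e : Expr} (ha : a.Evals W s x) (he : e.Evals W s v)
    (hQ : Q (s.setMem x v)) : Runs W (storeAt a e) s (a.cost + (e.cost + 1)) Q := fun s₀ hs₀ => by
  obtain ⟨s₁, e₁, m₁, v₁, f₁⟩ := ha.exec 20 le_rfl s₀ hs₀
  have hs₁ : Agree s₁ s := ⟨m₁.trans hs₀.1, fun r hr => (f₁ r hr).trans (hs₀.2 r hr)⟩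
  obtain ⟨s₂, e₂, m₂, v₂, f₂⟩ := he.exec 21 (by norm_num) s₁ hs₁
  have hs₂ : Agree s₂ s := ⟨m₂.trans hs₁.1, fun r hr => (f₂ r (by omega)).trans (hs₁.2 r hr)⟩
  have h20 : s₂.reg 20 = x := (f₂ 20 (by norm_num)).trans v₁
  have hst : RamExec W (.store 20 21) s₂ 1 (s₂.setMem x v) := by
    have := RamExec.store (W := W) s₂ 20 21 (by rw [v₂]; exact he.lt)
    rwa [h20, v₂] at this
  exact ⟨_, _, _, .seq e₁ (.seq e₂ hst), le_rfl, hs₂.setMem _ _, hQ⟩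

theorem ifNonzero {p : RamProg} {v T : ℕ} {e : Expr} (he : e.Evals W s v)
    (h₁ : v ≠ 0 → Runs W p s T Q) (h₀ : v = 0 → Q s) :
    Runs W (ifNonzero e p) s (e.cost + (T + 2)) Q := fun s₀ hs₀ => by
  obtain ⟨s₁, e₁, m₁, v₁, f₁⟩ := he.exec 20 le_rfl s₀ hs₀
  have hs₁ : Agree s₁ s := ⟨m₁.trans hs₀.1, fun r hr => (f₁ r hr).trans (hs₀.2 r hr)⟩
  by_cases hv : v = 0
  · exact ⟨_, s₁, s, .seq e₁ (.ite_false (by rw [v₁, hv]) (.skip _)), by omega, hs₁, h₀ hv⟩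
  · obtain ⟨t, s₂, s', e₂, ht, ha, hq⟩ := h₁ hv s₁ hs₁
    exact ⟨_, s₂, s', .seq e₁ (.ite_true (by rw [v₁]; exact hv) e₂), by omega, ha, hq⟩

/-- The rule for loops: `I k` holds whenever the loop variable has just been set to `k`. -/
theorem forLoop {p : RamProg} {i b n T : ℕ} (I : ℕ → RamState → Prop) (hi : i < 20) (hb : b < 20)
    (hib : i ≠ b) (hn : s.reg b = n) (hnW : n < W) (h₀ : I 0 (s.setReg i 0))
    (hstep : ∀ k < n, ∀ s', I k s' → s'.reg i = k → s'.reg b = n →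
      Runs W p s' T fun s'' => s''.reg i = k ∧ s''.reg b = n ∧ I (k + 1) (s''.setReg i (k + 1))) :
    Runs W (forLoop i b p) s (n * (T + 12) + 9) fun s' => I n s' ∧ s'.reg i = n := by
  have htest : ∀ (k : ℕ) (s' : RamState), s'.reg i = k → s'.reg b = n → k ≤ n →
      (Expr.sub (.var b) (.var i)).Evals W s' (n - k) := by
    rintro k s' rfl rfl hk
    exact .sub (.var b hb hnW) (.var i hi (by omega))
  have hloop : ∀ m k, k + m = n → ∀ s' s₀, I k s' → s'.reg i = k → s'.reg b = n → Agree s₀ s' →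
      s₀.reg 20 = n - k → ∃ t s₁ s'', RamExec W (.loop 20 (.seq p (.seq
        (CompactCovers.assign i (.add (.var i) (.lit 1)))
        (Expr.compile (.sub (.var b) (.var i)) 20)))) s₀ t s₁ ∧ t ≤ m * (T + 12) + 1 ∧
        Agree s₁ s'' ∧ I n s'' ∧ s''.reg i = n := by
    intro m
    induction m with
    | zero =>
      intro k hk s' s₀ hI hki _ ha h20
      obtain rfl : k = n := by omega
      -- the loop ends, since its test register is `0`
      have hend : ∀ p, RamExec W (.loop 20 p) s₀ 1 s₀ := fun p => by constructor; omega
      exact ⟨1, s₀, s', hend _, by omega, ha, hI, hki⟩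
    | succ m ih =>
      intro k hk s' s₀ hI hki hbi ha h20
      obtain ⟨t₁, s₁, s₁', e₁, ht₁, ha₁, hi₁, hb₁, hI₁⟩ := hstep k (by omega) s' hI hki hbi s₀ ha
      have hinc : (Expr.add (.var i) (.lit 1)).Evals W s₁' (k + 1) := by
        have := Expr.Evals.var (W := W) (s := s₁') i hi (by omega)
        rw [hi₁] at this
        exact .add this (.lit 1 (by omega)) (by omega)
      obtain ⟨t₂, s₂, s₂', e₂, ht₂, ha₂, rfl⟩ := assign (Q := (· = s₁'.setReg i (k + 1)))
        hinc hi rfl s₁ ha₁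
      have hk₂ : (s₁'.setReg i (k + 1)).reg i = k + 1 := by simp [RamState.setReg]
      have hb₂ : (s₁'.setReg i (k + 1)).reg b = n := by simp [RamState.setReg, hib.symm, hb₁]
      obtain ⟨s₃, e₃, m₃, v₃, f₃⟩ := (htest (k + 1) _ hk₂ hb₂ (by omega)).exec 20 le_rfl s₂ ha₂
      obtain ⟨t₄, s₄, s₄', e₄, ht₄, ha₄, hI₄⟩ := ih (k + 1) (by omega) _ s₃ hI₁ hk₂ hb₂
        ⟨m₃.trans ha₂.1, fun r hr => (f₃ r hr).trans (ha₂.2 r hr)⟩ v₃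
      refine ⟨_, s₄, s₄', .loop_step (by omega) (.seq e₁ (.seq e₂ e₃)) e₄, ?_, ha₄, hI₄⟩
      simp only [Expr.cost] at ht₂ ⊢
      rw [Nat.succ_mul]
      omega
  intro s₀ hs₀
  obtain ⟨t₁, s₁, s₁', e₁, ht₁, ha₁, rfl⟩ := assign (Q := (· = s.setReg i 0))
    (Expr.Evals.lit (W := W) (s := s) 0 (by omega)) hi rfl s₀ hs₀
  have hk₁ : (s.setReg i 0).reg i = 0 := by simp [RamState.setReg]
  have hb₁ : (s.setReg i 0).reg b = n := by simp [RamState.setReg, hib.symm, hn]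
  obtain ⟨s₂, e₂, m₂, v₂, f₂⟩ := (htest 0 _ hk₁ hb₁ (Nat.zero_le _)).exec 20 le_rfl s₁ ha₁
  obtain ⟨t₃, s₃, s₃', e₃, ht₃, ha₃, hI₃⟩ := hloop n 0 (by omega) _ s₂ h₀ hk₁ hb₁
    ⟨m₂.trans ha₁.1, fun r hr => (f₂ r hr).trans (ha₁.2 r hr)⟩ v₂
  refine ⟨_, s₃, s₃', .seq e₁ (.seq e₂ e₃), ?_, ha₃, hI₃⟩
  simp only [Expr.cost] at ht₁ ⊢
  omega

end Runs

/-- Add up the values of an expression for the values `0, …, n - 1` of the variable `k`, where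
`n` is the content of register `0`. -/
def sumLoop (k acc : ℕ) (e : Expr) : RamProg :=
  .seq (assign acc (.lit 0)) (forLoop k 0 (assign acc (.add (.var acc) e)))

theorem Runs.sumLoop {W : ℕ} {s : RamState} {k acc n : ℕ} {e : Expr} (f : ℕ → ℕ)
    (hk : k < 20) (hacc : acc < 20) (hk₀ : k ≠ 0) (hacc₀ : acc ≠ 0) (hka : k ≠ acc)
    (hn : s.reg 0 = n) (hnW : n < W) (hf : ∑ j ∈ Finset.range n, f j < W)
    (he : ∀ j < n, ∀ v, e.Evals W ((s.setReg acc v).setReg k j) (f j)) :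
    Runs W (sumLoop k acc e) s (n * (e.cost + 17) + 12)
      (· = (s.setReg acc (∑ j ∈ Finset.range n, f j)).setReg k n) := by
  have hcomm : ∀ v w v' w', ((((s.setReg acc v).setReg k w).setReg acc v').setReg k w') =
      (s.setReg acc v').setReg k w' := by
    intro v w v' w'
    simp only [RamState.setReg, RamState.mk.injEq, and_true]
    funext r
    by_cases h₁ : r = k <;> by_cases h₂ : r = acc <;> simp [h₁, h₂, Function.update_apply]
  refine Runs.mono (Runs.seq (Runs.assign (Q := (· = s.setReg acc 0)) (.lit 0 (by omega)) hacc rfl)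
    (T' := n * (e.cost + 5 + 12) + 9)
    (Q := (· = (s.setReg acc (∑ j ∈ Finset.range n, f j)).setReg k n))
    ?_) (by simp only [Expr.cost, Nat.add_assoc, Nat.reduceAdd]; omega) fun s' h => h
  rintro _ rfl
  refine Runs.mono (Runs.forLoop
    (fun j s' => s' = (s.setReg acc (∑ j ∈ Finset.range j, f j)).setReg k j)
    hk (by norm_num) hk₀ (n := n) (T := e.cost + 5) ?_ hnW (by simp) ?_) le_rfl fun s' h => h.1
  · simpa [RamState.setReg, hacc₀.symm] using hn
  · rintro j hj _ rfl _ h0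
    have hle : ∑ j ∈ Finset.range (j + 1), f j < W :=
      lt_of_le_of_lt (Finset.sum_le_sum_of_subset (Finset.range_subset_range.2 hj)) hf
    rw [Finset.sum_range_succ] at hle
    have hv := Expr.Evals.var (W := W)
      (s := (s.setReg acc (∑ j ∈ Finset.range j, f j)).setReg k j) acc hacc (by
        simp [RamState.setReg, hka.symm]; omega)
    have hval : ((s.setReg acc (∑ j ∈ Finset.range j, f j)).setReg k j).reg acc =
        ∑ j ∈ Finset.range j, f j := by simp [RamState.setReg, hka.symm]
    rw [hval] at hv
    refine Runs.mono (Runs.assign (.add hv (he j hj _) hle) hacc ?_) (by simp only [Expr.cost]; omega)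
      fun s' h => h
    refine ⟨by simp [RamState.setReg, hka], ?_, ?_⟩
    · rw [← h0]; simp [RamState.setReg, hacc₀.symm]
    · rw [hcomm, Finset.sum_range_succ]

/-! ### Memory layout -/

/-- The distance of two numbers. -/
def adiff (a b : ℕ) : ℕ := (a - b) + (b - a)

/-- The state holds `n` in register `0`, and in its memory an `n × n` matrix `M`, followed by
arrays `A`, `C`, `F` of length `n`.  In the algorithm, `M` is the matrix of closed neighborhoods, `A`
indicates the vertices that have not been removed yet, `C` holds the centers, and `F` indicates
representatives of the traces on the alive vertices. -/
structure Heap (n : ℕ) (M : ℕ → ℕ → ℕ) (A C F : ℕ → ℕ) (s : RamState) : Prop where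
  size : s.reg 0 = n
  matrix : ∀ i < n, ∀ j < n, s.mem (i * n + j) = M i j
  alive : ∀ i < n, s.mem (n * n + i) = A i
  center : ∀ i < n, s.mem (n * n + n + i) = C i
  first : ∀ i < n, s.mem (n * n + n + n + i) = F i
  matrix_le : ∀ i < n, ∀ j < n, M i j ≤ 1
  alive_le : ∀ i < n, A i ≤ 1
  center_le : ∀ i < n, C i ≤ n
  first_le : ∀ i < n, F i ≤ 1

theorem index_lt {n i j : ℕ} (hi : i < n) (hj : j < n) : i * n + j < n * n := by
  have : (i + 1) * n ≤ n * n := Nat.mul_le_mul_right _ hi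
  rw [Nat.succ_mul] at this
  omega

theorem index_inj {n i j i' j' : ℕ} (hj : j < n) (hj' : j' < n) (h : i * n + j = i' * n + j') :
    i = i' ∧ j = j' := by
  have hn : 0 < n := by omega
  have h₁ := congrArg (· / n) h
  have h₂ := congrArg (· % n) h
  simp only [Nat.mul_comm _ n, Nat.mul_add_div hn, Nat.mul_add_mod, Nat.div_eq_of_lt hj,
    Nat.div_eq_of_lt hj', Nat.mod_eq_of_lt hj, Nat.mod_eq_of_lt hj', Nat.add_zero] at h₁ h₂
  exact ⟨h₁, h₂⟩

namespace Heap

variable {n : ℕ} {M : ℕ → ℕ → ℕ} {A C F : ℕ → ℕ} {s : RamState}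

theorem setReg (h : Heap n M A C F s) {r : ℕ} (hr : r ≠ 0) (v : ℕ) :
    Heap n M A C F (s.setReg r v) :=
  { h with size := by simpa [RamState.setReg, hr.symm] using h.size }

theorem setMatrix (h : Heap n M A C F s) {i j v : ℕ} (hi : i < n) (hj : j < n) (hv : v ≤ 1) :
    Heap n (Function.update M i (Function.update (M i) j v)) A C F (s.setMem (i * n + j) v) := by
  have hij := index_lt hi hj
  refine ⟨h.size, fun i' hi' j' hj' => ?_, fun k hk => ?_, fun k hk => ?_, fun k hk => ?_,
    fun i' hi' j' hj' => ?_, h.alive_le, h.center_le, h.first_le⟩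
  · by_cases h' : i' * n + j' = i * n + j
    · obtain ⟨rfl, rfl⟩ := index_inj hj' hj h'
      simp [RamState.setMem]
    · simp only [RamState.setMem, Function.update_of_ne h']
      rw [h.matrix i' hi' j' hj']
      by_cases hii : i' = i
      · subst hii
        have : j' ≠ j := fun hjj => h' (by rw [hjj])
        simp [this]
      · simp [hii]
  · simpa [RamState.setMem, show n * n + k ≠ i * n + j by omega] using h.alive k hk
  · simpa [RamState.setMem, show n * n + n + k ≠ i * n + j by omega] using h.center k hk
  · simpa [RamState.setMem, show n * n + n + n + k ≠ i * n + j by omega] using h.first k hk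
  · by_cases hii : i' = i
    · subst hii
      by_cases hjj : j' = j
      · subst hjj; simpa using hv
      · simpa [hjj] using h.matrix_le i' hi' j' hj'
    · simpa [hii] using h.matrix_le i' hi' j' hj'

theorem setAlive (h : Heap n M A C F s) {i v : ℕ} (hi : i < n) (hv : v ≤ 1) :
    Heap n M (Function.update A i v) C F (s.setMem (n * n + i) v) := by
  refine ⟨h.size, fun i' hi' j' hj' => ?_, fun k hk => ?_, fun k hk => ?_, fun k hk => ?_,
    h.matrix_le, fun k hk => ?_, h.center_le, h.first_le⟩
  · have := index_lt hi' hj'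
    simpa [RamState.setMem, show i' * n + j' ≠ n * n + i by omega] using h.matrix i' hi' j' hj'
  · by_cases hki : k = i
    · subst hki; simp [RamState.setMem]
    · simpa [RamState.setMem, hki] using h.alive k hk
  · simpa [RamState.setMem, show n * n + n + k ≠ n * n + i by omega] using h.center k hk
  · simpa [RamState.setMem, show n * n + n + n + k ≠ n * n + i by omega] using h.first k hk
  · by_cases hki : k = i
    · subst hki; simpa using hv
    · simpa [hki] using h.alive_le k hk

theorem setCenter (h : Heap n M A C F s) {i v : ℕ} (hi : i < n) (hv : v ≤ n) :
    Heap n M A (Function.update C i v) F (s.setMem (n * n + n + i) v) := by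
  refine ⟨h.size, fun i' hi' j' hj' => ?_, fun k hk => ?_, fun k hk => ?_, fun k hk => ?_,
    h.matrix_le, h.alive_le, fun k hk => ?_, h.first_le⟩
  · have := index_lt hi' hj'
    simpa [RamState.setMem, show i' * n + j' ≠ n * n + n + i by omega] using h.matrix i' hi' j' hj'
  · simpa [RamState.setMem, show n * n + k ≠ n * n + n + i by omega] using h.alive k hk
  · by_cases hki : k = i
    · subst hki; simp [RamState.setMem]
    · simpa [RamState.setMem, hki] using h.center k hk
  · simpa [RamState.setMem, show n * n + n + n + k ≠ n * n + n + i by omega] using h.first k hk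
  · by_cases hki : k = i
    · subst hki; simpa using hv
    · simpa [hki] using h.center_le k hk

theorem setFirst (h : Heap n M A C F s) {i v : ℕ} (hi : i < n) (hv : v ≤ 1) :
    Heap n M A C (Function.update F i v) (s.setMem (n * n + n + n + i) v) := by
  refine ⟨h.size, fun i' hi' j' hj' => ?_, fun k hk => ?_, fun k hk => ?_, fun k hk => ?_,
    h.matrix_le, h.alive_le, h.center_le, fun k hk => ?_⟩
  · have := index_lt hi' hj'
    simpa [RamState.setMem, show i' * n + j' ≠ n * n + n + n + i by omega]
      using h.matrix i' hi' j' hj'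
  · simpa [RamState.setMem, show n * n + k ≠ n * n + n + n + i by omega] using h.alive k hk
  · simpa [RamState.setMem, show n * n + n + k ≠ n * n + n + n + i by omega] using h.center k hk
  · by_cases hki : k = i
    · subst hki; simp [RamState.setMem]
    · simpa [RamState.setMem, hki] using h.first k hk
  · by_cases hki : k = i
    · subst hki; simpa using hv
    · simpa [hki] using h.first_le k hk

theorem setOutput (h : Heap n M A C F s) {a : ℕ} (ha : n * n + n + n + n ≤ a) (v : ℕ) :
    Heap n M A C F (s.setMem a v) := by
  refine ⟨h.size, fun i' hi' j' hj' => ?_, fun k hk => ?_, fun k hk => ?_, fun k hk => ?_,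
    h.matrix_le, h.alive_le, h.center_le, h.first_le⟩
  · have := index_lt hi' hj'
    simpa [RamState.setMem, show i' * n + j' ≠ a by omega] using h.matrix i' hi' j' hj'
  · simpa [RamState.setMem, show n * n + k ≠ a by omega] using h.alive k hk
  · simpa [RamState.setMem, show n * n + n + k ≠ a by omega] using h.center k hk
  · simpa [RamState.setMem, show n * n + n + n + k ≠ a by omega] using h.first k hk

end Heap

namespace Expr

/-- The address of an entry of the matrix. -/
def matrixAddr (i j : Expr) : Expr := add (mul i (var 0)) j
/-- The address of an entry of the first array. -/
def aliveAddr (i : Expr) : Expr := add (mul (var 0) (var 0)) i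
/-- The address of an entry of the second array. -/
def centerAddr (i : Expr) : Expr := add (add (mul (var 0) (var 0)) (var 0)) i
/-- The address of an entry of the third array. -/
def firstAddr (i : Expr) : Expr := add (add (add (mul (var 0) (var 0)) (var 0)) (var 0)) i
/-- The address behind the arrays. -/
def outAddr : Expr := add (add (add (mul (var 0) (var 0)) (var 0)) (var 0)) (var 0)
/-- The expression for `adiff`. -/
def dist (a b : Expr) : Expr := add (sub a b) (sub b a)

/-- Words are large enough for all numbers that the algorithm handles. -/
def WordFits (W n : ℕ) : Prop := 2 * (n * n) + 8 * n + 16 ≤ W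

variable {W n : ℕ} {M : ℕ → ℕ → ℕ} {A C F : ℕ → ℕ} {s : RamState} {a b : Expr} {x y : ℕ}

theorem Evals.var' {r v : ℕ} (hr : r < 20) (h : s.reg r = v) (hv : v < W) :
    Evals W s (.var r) v := by
  subst h; exact .var r hr hv

theorem Evals.size (h : Heap n M A C F s) (hW : WordFits W n) : Evals W s (.var 0) n :=
  .var' (by norm_num) h.size (by unfold WordFits at hW; omega)

theorem Evals.square (h : Heap n M A C F s) (hW : WordFits W n) :
    Evals W s (.mul (.var 0) (.var 0)) (n * n) :=
  .mul (.size h hW) (.size h hW) (by unfold WordFits at hW; omega)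

theorem Evals.matrixAddr (ha : Evals W s a x) (hb : Evals W s b y) (h : Heap n M A C F s)
    (hW : WordFits W n) (hx : x < n) (hy : y < n) : Evals W s (matrixAddr a b) (x * n + y) := by
  have := index_lt hx hy
  unfold WordFits at hW
  exact .add (.mul ha (.size h hW) (by omega)) hb (by omega)

theorem Evals.matrix (ha : Evals W s a x) (hb : Evals W s b y) (h : Heap n M A C F s)
    (hW : WordFits W n) (hx : x < n) (hy : y < n) : Evals W s (.mem (.matrixAddr a b)) (M x y) := by
  have h₁ := h.matrix_le x hx y hy
  have := Evals.mem (ha.matrixAddr hb h hW hx hy)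
  rw [h.matrix x hx y hy] at this
  exact this (by unfold WordFits at hW; omega)

theorem Evals.aliveAddr (ha : Evals W s a x) (h : Heap n M A C F s)
    (hW : WordFits W n) (hx : x < n) : Evals W s (aliveAddr a) (n * n + x) :=
  .add (.square h hW) ha (by unfold WordFits at hW; omega)

theorem Evals.alive (ha : Evals W s a x) (h : Heap n M A C F s)
    (hW : WordFits W n) (hx : x < n) : Evals W s (.mem (.aliveAddr a)) (A x) := by
  have h₁ := h.alive_le x hx
  have := Evals.mem (ha.aliveAddr h hW hx)
  rw [h.alive x hx] at this
  exact this (by unfold WordFits at hW; omega)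

theorem Evals.centerAddr (ha : Evals W s a x) (h : Heap n M A C F s)
    (hW : WordFits W n) (hx : x < n) : Evals W s (centerAddr a) (n * n + n + x) := by
  have h₁ := hW
  unfold WordFits at h₁
  exact .add (.add (.square h hW) (.size h hW) (by omega)) ha (by omega)

theorem Evals.center (ha : Evals W s a x) (h : Heap n M A C F s)
    (hW : WordFits W n) (hx : x < n) : Evals W s (.mem (.centerAddr a)) (C x) := by
  have h₁ := h.center_le x hx
  have := Evals.mem (ha.centerAddr h hW hx)
  rw [h.center x hx] at this
  exact this (by unfold WordFits at hW; omega)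

theorem Evals.firstAddr (ha : Evals W s a x) (h : Heap n M A C F s)
    (hW : WordFits W n) (hx : x < n) : Evals W s (firstAddr a) (n * n + n + n + x) := by
  have h₁ := hW
  unfold WordFits at h₁
  exact .add (.add (.add (.square h hW) (.size h hW) (by omega)) (.size h hW) (by omega)) ha
    (by omega)

theorem Evals.first (ha : Evals W s a x) (h : Heap n M A C F s)
    (hW : WordFits W n) (hx : x < n) : Evals W s (.mem (.firstAddr a)) (F x) := by
  have h₁ := h.first_le x hx
  have := Evals.mem (ha.firstAddr h hW hx)
  rw [h.first x hx] at this
  exact this (by unfold WordFits at hW; omega)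

theorem Evals.outAddr (h : Heap n M A C F s) (hW : WordFits W n) :
    Evals W s outAddr (n * n + n + n + n) := by
  have h₁ := hW
  unfold WordFits at h₁
  exact .add (.add (.add (.square h hW) (.size h hW) (by omega)) (.size h hW) (by omega))
    (.size h hW) (by omega)

theorem Evals.dist (ha : Evals W s a x) (hb : Evals W s b y) : Evals W s (dist a b) (adiff x y) :=
  .add (.sub ha hb) (.sub hb ha) (by have := ha.lt; have := hb.lt; omega)

end Expr

/-! ### Removing one vertex -/

/-- The number of indices `k` with weight `B k = 1` at which the rows `x` and `y` of a 0-1-matrix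
differ. -/
def rowDist (M : ℕ → ℕ → ℕ) (B : ℕ → ℕ) (n x y : ℕ) : ℕ :=
  ∑ k ∈ range n, B k * adiff (M x k) (M y k)

/-- The indicator of the rows `w` that differ from all earlier rows at some index `k` with
`A k = 1`. -/
def firstRow (M : ℕ → ℕ → ℕ) (A : ℕ → ℕ) (n w : ℕ) : ℕ :=
  if ∀ w' < w, rowDist M A n w w' ≠ 0 then 1 else 0

/-- The quantity that is minimized over all pairs `x`, `y`.  For distinct alive vertices, it is the
number of representatives that separate them; the other summands make sure that such a pair is
preferred to two equal alive vertices, and this to the other pairs. -/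
def pairCost (M : ℕ → ℕ → ℕ) (A F : ℕ → ℕ) (n x y : ℕ) : ℕ :=
  rowDist M F n x y + (1 - adiff x y) * (n + 1) + (1 - A x * A y) * (n + 2)

section Programs

variable {W n : ℕ} {M : ℕ → ℕ → ℕ} {A C F : ℕ → ℕ} {s : RamState}

theorem adiff_le_one {a b : ℕ} (ha : a ≤ 1) (hb : b ≤ 1) : adiff a b ≤ 1 := by
  unfold adiff; omega

theorem rowDist_le {B : ℕ → ℕ} {x y : ℕ} (hM : ∀ i < n, ∀ j < n, M i j ≤ 1) (hx : x < n)
    (hy : y < n) (hB : ∀ k < n, B k ≤ 1) : rowDist M B n x y ≤ n := by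
  calc rowDist M B n x y ≤ ∑ k ∈ range n, 1 := sum_le_sum fun k hk => by
        rw [mem_range] at hk
        exact Nat.mul_le_mul (hB k hk) (adiff_le_one (hM x hx k hk) (hM y hy k hk))
    _ = n := by simp

/-- Compute `rowDist` in the register `acc`, for the rows in the registers `x` and `y`. -/
def rowDistProg (k acc x y : ℕ) (B : Expr) : RamProg :=
  sumLoop k acc (.mul B (.dist (.mem (.matrixAddr (.var x) (.var k)))
    (.mem (.matrixAddr (.var y) (.var k)))))

theorem runs_rowDistProg {k acc x y i j : ℕ} {B : Expr} {f : ℕ → ℕ} (h : Heap n M A C F s)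
    (hW : Expr.WordFits W n) (hk : k < 20) (hacc : acc < 20) (hx : x < 20) (hy : y < 20)
    (hk₀ : k ≠ 0) (hacc₀ : acc ≠ 0) (hka : k ≠ acc) (hxk : x ≠ k) (hxa : x ≠ acc) (hyk : y ≠ k)
    (hya : y ≠ acc) (hi : s.reg x = i) (hj : s.reg y = j) (hin : i < n) (hjn : j < n)
    (hf : ∀ l < n, f l ≤ 1) (hcost : B.cost ≤ 20)
    (hB : ∀ s', Heap n M A C F s' → ∀ l < n, s'.reg k = l → B.Evals W s' (f l)) :
    Runs W (rowDistProg k acc x y B) s (n * 80 + 12)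
      (· = (s.setReg acc (rowDist M f n i j)).setReg k n) := by
  have hW' := hW
  unfold Expr.WordFits at hW'
  have hle := rowDist_le h.matrix_le hin hjn hf
  refine Runs.mono (Runs.sumLoop (n := n) (fun l => f l * adiff (M i l) (M j l)) hk hacc hk₀ hacc₀
    hka h.size (by omega) (lt_of_le_of_lt hle (by omega)) ?_) ?_ fun s' h => h
  · intro l hl v
    have h' := (h.setReg hacc₀ v).setReg hk₀ l
    have hkl : ((s.setReg acc v).setReg k l).reg k = l := by simp [RamState.setReg]
    have ek := Expr.Evals.var' (W := W) hk hkl (by omega)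
    have ex := Expr.Evals.var' (W := W) (s := (s.setReg acc v).setReg k l) (v := i) hx
      (by simpa [RamState.setReg, hxk, hxa] using hi) (by omega)
    have ey := Expr.Evals.var' (W := W) (s := (s.setReg acc v).setReg k l) (v := j) hy
      (by simpa [RamState.setReg, hyk, hya] using hj) (by omega)
    refine .mul (hB _ h' l hl hkl)
      (.dist (.matrix ex ek h' hW hin hl) (.matrix ey ek h' hW hjn hl)) ?_
    have := Nat.mul_le_mul (hf l hl) (adiff_le_one (h.matrix_le i hin l hl) (h.matrix_le j hjn l hl))
    omega
  · simp only [Expr.cost, Expr.dist, Expr.matrixAddr]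
    have : n * (B.cost + 60) ≤ n * 80 := Nat.mul_le_mul_left _ (by omega)
    refine Nat.add_le_add_right (le_trans (Nat.mul_le_mul_left _ ?_) this) _
    omega

/-- Compute `firstRow` in the third array. -/
def firstProg : RamProg :=
  forLoop 6 0 (.seq (assign 7 (.lit 1)) (.seq
    (forLoop 8 6 (.seq (rowDistProg 10 9 6 8 (.mem (.aliveAddr (.var 10))))
      (assign 7 (.mul (.var 7) (.sub (.lit 1) (.sub (.lit 1) (.var 9)))))))
    (storeAt (.firstAddr (.var 6)) (.var 7))))

theorem runs_firstProg (h : Heap n M A C F s) (hW : Expr.WordFits W n) :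
    Runs W firstProg s (n * (n * (n * 80 + 40) + 60) + 9) fun s' =>
      ∃ F', Heap n M A C F' s' ∧ (∀ w < n, F' w = firstRow M A n w) ∧
        ∀ r < 6, s'.reg r = s.reg r := by
  have hW' := hW
  unfold Expr.WordFits at hW'
  refine Runs.mono (Runs.forLoop (n := n) (T := n * (n * 80 + 40) + 48)
    (fun w s' => ∃ F', Heap n M A C F' s' ∧ (∀ u < w, F' u = firstRow M A n u) ∧ ∀ r < 6, s'.reg r = s.reg r) (by norm_num) (by norm_num)
    (by norm_num) h.size (by omega) ⟨F, h.setReg (by norm_num) _, by simp, fun r hr => ?_⟩ ?_) ?_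
    fun s' hs' => hs'.1
  · simp [RamState.setReg, show r ≠ 6 by omega]
  · rintro w hw s₁ ⟨F₁, h₁, hF₁, hr₁⟩ hw₁ -
    -- after `j` steps, the register `7` tells whether row `w` differs from the first `j` rows
    refine Runs.mono (Runs.seq (Runs.assign (Q := (· = s₁.setReg 7 1)) (.lit 1 (by omega))
      (by norm_num) rfl) (T' := (w * (n * 80 + 12 + 12 + 12) + 9) + 20)
      fun s₂ hs₂ => Runs.seq (Runs.forLoop (n := w)
        (T := n * 80 + 12 + 12)
        (fun j s' => Heap n M A C F₁ s' ∧
          s'.reg 7 = (if ∀ w' < j, rowDist M A n w w' ≠ 0 then 1 else 0) ∧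
          ∀ r < 7, s'.reg r = s₁.reg r)
        (by norm_num) (by norm_num) (by norm_num) ?_ (by omega) ?_ ?_) ?_) ?_ fun s' hs' => hs'
    · subst hs₂; simpa [RamState.setReg] using hw₁
    · subst hs₂
      refine ⟨(h₁.setReg (by norm_num) _).setReg (by norm_num) _, by simp [RamState.setReg],
        fun r hr => ?_⟩
      simp [RamState.setReg, show r ≠ 7 by omega, show r ≠ 8 by omega]
    · rintro j hj s₃ ⟨h₃, h7, hr₃⟩ h8 h6
      refine Runs.mono (Runs.seq (runs_rowDistProg (f := A) h₃ hW (by norm_num) (by norm_num)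
        (by norm_num) (by norm_num) (by norm_num) (by norm_num) (by norm_num) (by norm_num)
        (by norm_num) (by norm_num) (by norm_num) h6 h8 hw (by omega) h₃.alive_le (by decide)
        fun s' h' l hl hkl => (Expr.Evals.var' (by norm_num) hkl (by omega)).alive h' hW hl)
        (T' := 12) ?_) le_rfl fun s' h => h
      rintro _ rfl
      have hd : rowDist M A n w j ≤ n :=
        rowDist_le h₃.matrix_le hw (by omega) h₃.alive_le
      set flag := (if ∀ w' < j, rowDist M A n w w' ≠ 0 then 1 else 0) with hflag
      have hflag1 : flag ≤ 1 := by rw [hflag]; split_ifs <;> omega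
      have hmul : flag * (1 - (1 - rowDist M A n w j)) =
          if ∀ w' < j + 1, rowDist M A n w w' ≠ 0 then 1 else 0 := by
        rw [hflag]
        simp only [Nat.forall_lt_succ_right]
        by_cases h₀ : rowDist M A n w j = 0
        · simp [h₀]
        · have : 1 - (1 - rowDist M A n w j) = 1 := by omega
          rw [this, mul_one]
          simp only [h₀, ne_eq, not_false_eq_true, and_true]
      refine Runs.mono (Runs.assign (v := flag * (1 - (1 - rowDist M A n w j)))
        (.mul (.var' (by norm_num) ?_ (by omega)) (.sub (.lit 1 (by omega))
          (.sub (.lit 1 (by omega)) (.var' (by norm_num) ?_ (by omega)))) ?_)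
        (by norm_num) ⟨?_, ?_, ?_, ?_, ?_⟩) (by decide) fun s' h => h
      · simpa [RamState.setReg] using h7
      · simp [RamState.setReg]
      · rw [hmul]; split_ifs <;> omega
      · simpa [RamState.setReg] using h8
      · simpa [RamState.setReg] using h6
      · exact (((h₃.setReg (by norm_num) _).setReg (by norm_num) _).setReg (by norm_num) _).setReg
          (by norm_num) _
      · rw [hmul]; simp [RamState.setReg]
      · intro r hr
        simpa [RamState.setReg, show r ≠ 7 by omega, show r ≠ 8 by omega, show r ≠ 9 by omega,
          show r ≠ 10 by omega] using hr₃ r hr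
    · rintro s₃ ⟨⟨h₃, h7, hr₃⟩, -⟩
      have h6 : s₃.reg 6 = w := (hr₃ 6 (by norm_num)).trans hw₁
      have hflag1 : (if ∀ w' < w, rowDist M A n w w' ≠ 0 then 1 else 0) ≤ 1 := by
        split_ifs <;> omega
      have e6 := Expr.Evals.var' (W := W) (by norm_num) h6 (by omega)
      refine Runs.mono (Runs.storeAt (e6.firstAddr h₃ hW hw) (.var' (by norm_num) h7 (by omega)) ?_)
        (T' := 20) (by decide) fun s' h => h
      refine ⟨h6, h₃.size, _, (h₃.setFirst hw hflag1).setReg (by norm_num) _, fun u hu => ?_,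
        fun r hr => ?_⟩
      · by_cases huw : u = w
        · subst huw; simp [firstRow]
        · rw [Function.update_of_ne huw, hF₁ u (by omega)]
      · simpa [RamState.setReg, RamState.setMem, show r ≠ 6 by omega] using
          (hr₃ r (by omega)).trans (hr₁ r hr)
    · have : w * (n * 80 + 12 + 12 + 12) ≤ n * (n * 80 + 40) := Nat.mul_le_mul hw.le (by omega)
      simp only [Expr.cost]
      omega
  · have : n * (n * (n * 80 + 40) + 48 + 12) = n * (n * (n * 80 + 40) + 60) := by ring
    omega

/-- The value of `pairCost` for the vertices in the registers `8` and `9`, if `rowDist` is in the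
register `10`. -/
def pairCostExpr : Expr :=
  .add (.add (.var 10) (.mul (.sub (.lit 1) (.dist (.var 8) (.var 9))) (.add (.var 0) (.lit 1))))
    (.mul (.sub (.lit 1) (.mul (.mem (.aliveAddr (.var 8))) (.mem (.aliveAddr (.var 9)))))
      (.add (.var 0) (.lit 2)))

/-- Compute `pairCost` for the vertices in the registers `8` and `9`.  If it is smaller than the
register `6`, then store it there, and the first vertex in the register `7`. -/
def compareProg : RamProg :=
  .seq (rowDistProg 11 10 8 9 (.mem (.firstAddr (.var 11))))
    (.seq (assign 12 pairCostExpr) (ifNonzero (.sub (.var 6) (.var 12))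
      (.seq (assign 6 (.var 12)) (assign 7 (.var 8)))))

/-- Find a pair `x`, `y` that minimizes `pairCost`, and leave `x` in the register `7`. -/
def selectProg : RamProg :=
  .seq (assign 6 (.add (.add (.var 0) (.var 0)) (.lit 5))) (.seq (assign 7 (.lit 0))
    (forLoop 8 0 (forLoop 9 0 compareProg)))

theorem pairCost_lt {x y : ℕ} (h : Heap n M A C F s) (hx : x < n) (hy : y < n) :
    pairCost M A F n x y < 2 * n + 5 := by
  have h₁ := rowDist_le h.matrix_le hx hy h.first_le
  unfold pairCost
  by_cases hxy : x = y
  · subst hxy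
    have : rowDist M F n x x = 0 := sum_eq_zero fun k _ => by simp [adiff]
    have h₂ : (1 - adiff x x) * (n + 1) = n + 1 := by simp [adiff]
    have h₃ : (1 - A x * A x) * (n + 2) ≤ 1 * (n + 2) := Nat.mul_le_mul_right _ (Nat.sub_le _ _)
    omega
  · have h₂ : 1 - adiff x y = 0 := by unfold adiff; omega
    have h₃ : (1 - A x * A y) * (n + 2) ≤ 1 * (n + 2) := Nat.mul_le_mul_right _ (Nat.sub_le _ _)
    rw [h₂, Nat.zero_mul]
    omega

/-- The registers `6` and `7` hold the least `pairCost` of the pairs processed so far, and the first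
component of a pair that attains it. -/
def Selected (M : ℕ → ℕ → ℕ) (A F : ℕ → ℕ) (n : ℕ) (done : ℕ → ℕ → Prop) (s : RamState) : Prop :=
  s.reg 6 ≤ 2 * n + 5 ∧ (∀ x < n, ∀ y < n, done x y → s.reg 6 ≤ pairCost M A F n x y) ∧
    (s.reg 6 = 2 * n + 5 ∨ s.reg 7 < n ∧ ∃ y < n, pairCost M A F n (s.reg 7) y = s.reg 6)

theorem Selected.of_reg {d d' : ℕ → ℕ → Prop} {s' : RamState} (h : Selected M A F n d s)
    (hd : ∀ x < n, ∀ y < n, d' x y → d x y) (h6 : s'.reg 6 = s.reg 6) (h7 : s'.reg 7 = s.reg 7) :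
    Selected M A F n d' s' := by
  obtain ⟨h₁, h₂, h₃⟩ := h
  refine ⟨h6 ▸ h₁, fun x hx y hy hxy => ?_, ?_⟩
  · rw [h6]; exact h₂ x hx y hy (hd x hx y hy hxy)
  · rw [h6, h7]; exact h₃

theorem runs_compareProg {x y : ℕ} {d : ℕ → ℕ → Prop} (h : Heap n M A C F s)
    (hW : Expr.WordFits W n) (hs : Selected M A F n d s) (h8 : s.reg 8 = x) (h9 : s.reg 9 = y)
    (hx : x < n) (hy : y < n) :
    Runs W compareProg s (n * 80 + 120) fun s' => Heap n M A C F s' ∧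
      (∀ r < 6, s'.reg r = s.reg r) ∧ s'.reg 8 = x ∧ s'.reg 9 = y ∧
      Selected M A F n (fun x' y' => d x' y' ∨ x' = x ∧ y' = y) s' := by
  have hW' := hW
  unfold Expr.WordFits at hW'
  refine Runs.mono (Runs.seq (T' := 108) (runs_rowDistProg (f := F) h hW (by norm_num) (by norm_num)
    (by norm_num) (by norm_num) (by norm_num) (by norm_num) (by norm_num) (by norm_num)
    (by norm_num) (by norm_num) (by norm_num) h8 h9 hx hy h.first_le (by decide)
    fun s' h' l hl hkl => (Expr.Evals.var' (by norm_num) hkl (by omega)).first h' hW hl) ?_)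
    (by omega) fun s' h => h
  rintro s₃ hs₃
  have h₃ : Heap n M A C F s₃ := by
    rw [hs₃]; exact (h.setReg (by norm_num) _).setReg (by norm_num) _
  have hr₃ : ∀ r < 10, s₃.reg r = s.reg r := fun r hr => by
    simp [hs₃, RamState.setReg, show r ≠ 10 by omega, show r ≠ 11 by omega]
  have h10 : s₃.reg 10 = rowDist M F n x y := by simp [hs₃, RamState.setReg]
  clear hs₃
  have hd := rowDist_le h₃.matrix_le hx hy h₃.first_le
  have hc := pairCost_lt h₃ hx hy
  have hA : A x * A y ≤ 1 := Nat.mul_le_mul (h₃.alive_le x hx) (h₃.alive_le y hy)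
  have e8 : Expr.Evals W s₃ (.var 8) x :=
    .var' (by norm_num) ((hr₃ 8 (by norm_num)).trans h8) (by omega)
  have e9 : Expr.Evals W s₃ (.var 9) y :=
    .var' (by norm_num) ((hr₃ 9 (by norm_num)).trans h9) (by omega)
  have he : pairCostExpr.Evals W s₃ (pairCost M A F n x y) := by
    have hc' := hc
    unfold pairCost at hc'
    exact .add (.add (.var' (by norm_num) h10 (by omega)) (.mul (.sub (.lit 1 (by omega))
      (.dist e8 e9)) (.add (.size h₃ hW) (.lit 1 (by omega)) (by omega)) (by omega)) (by omega))
      (.mul (.sub (.lit 1 (by omega)) (.mul (e8.alive h₃ hW hx) (e9.alive h₃ hW hy) (by omega)))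
        (.add (.size h₃ hW) (.lit 2 (by omega)) (by omega)) (by omega)) (by omega)
  refine Runs.mono (Runs.seq (Runs.assign (Q := (· = s₃.setReg 12 (pairCost M A F n x y))) he
    (by norm_num) rfl) (T' := 20) ?_) (by decide) fun s' h => h
  intro s₄ hs₄
  have h₄ : Heap n M A C F s₄ := by rw [hs₄]; exact h₃.setReg (by norm_num) _
  have hr₄ : ∀ r < 10, s₄.reg r = s.reg r := fun r hr => by
    simpa [hs₄, RamState.setReg, show r ≠ 12 by omega] using hr₃ r hr
  have h12 : s₄.reg 12 = pairCost M A F n x y := by simp [hs₄, RamState.setReg]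
  clear hs₄
  have hs₄ : Selected M A F n d s₄ :=
    hs.of_reg (fun _ _ _ _ h => h) (hr₄ 6 (by norm_num)) (hr₄ 7 (by norm_num))
  have h8' := (hr₄ 8 (by norm_num)).trans h8
  have h9' := (hr₄ 9 (by norm_num)).trans h9
  have h6le := hs₄.1
  have e12 : Expr.Evals W s₄ (.var 12) (pairCost M A F n x y) :=
    .var' (by norm_num) h12 (by omega)
  refine Runs.mono (Runs.ifNonzero (T := 4 + 4)
    (.sub (.var' (by norm_num) rfl (by omega)) e12) (fun hlt => ?_) fun hge => ?_) (by decide)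
    fun s' h => h
  · refine Runs.seq (Runs.assign (Q := (· = s₄.setReg 6 (pairCost M A F n x y))) e12
      (by norm_num) rfl) ?_
    rintro _ rfl
    refine Runs.assign (v := x) (.var' (by norm_num) ?_ (by omega)) (by norm_num) ⟨?_, ?_, ?_, ?_, ?_⟩
    · simpa [RamState.setReg] using h8'
    · exact (h₄.setReg (by norm_num) _).setReg (by norm_num) _
    · intro r hr
      simpa [RamState.setReg, show r ≠ 6 by omega, show r ≠ 7 by omega] using hr₄ r (by omega)
    · simpa [RamState.setReg] using h8'
    · simpa [RamState.setReg] using h9'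
    · refine ⟨?_, fun x' hx' y' hy' hd => ?_, Or.inr ⟨?_, y, hy, ?_⟩⟩
      · simp [RamState.setReg]; omega
      · simp only [RamState.setReg]
        rw [Function.update_of_ne (by norm_num), Function.update_self]
        rcases hd with hd | ⟨rfl, rfl⟩
        · have := hs₄.2.1 x' hx' y' hy' hd
          omega
        · exact le_rfl
      · simpa [RamState.setReg] using hx
      · simp [RamState.setReg]
  · refine ⟨h₄, fun r hr => hr₄ r (by omega), h8', h9', h6le, fun x' hx' y' hy' hd => ?_, hs₄.2.2⟩
    rcases hd with hd | ⟨rfl, rfl⟩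
    · exact hs₄.2.1 x' hx' y' hy' hd
    · omega

theorem runs_selectProg (h : Heap n M A C F s) (hW : Expr.WordFits W n) :
    Runs W selectProg s (n * (n * (n * 80 + 150) + 30) + 30) fun s' =>
      Heap n M A C F s' ∧ (∀ r < 6, s'.reg r = s.reg r) ∧
        (0 < n → s'.reg 7 < n ∧ ∃ y < n, ∀ x' < n, ∀ y' < n,
          pairCost M A F n (s'.reg 7) y ≤ pairCost M A F n x' y') := by
  have hW' := hW
  unfold Expr.WordFits at hW'
  refine Runs.mono (Runs.seq (Runs.assign (Q := (· = s.setReg 6 (n + n + 5)))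
    (.add (.add (.size h hW) (.size h hW) (by omega)) (.lit 5 (by omega)) (by omega))
      (by norm_num) rfl)
    (T' := 3 + (n * (n * (n * 80 + 132) + 21) + 9)) ?_) ?_ fun s' hs' => hs'
  rotate_left
  · simp only [Expr.cost]
    nlinarith
  rintro _ rfl
  refine Runs.seq (Runs.assign (Q := (· = (s.setReg 6 (n + n + 5)).setReg 7 0)) (.lit 0 (by omega))
    (by norm_num) rfl) ?_
  rintro _ rfl
  refine Runs.mono (Runs.forLoop (n := n) (T := n * (n * 80 + 132) + 9)
    (fun x s' => Heap n M A C F s' ∧ (∀ r < 6, s'.reg r = s.reg r) ∧ Selected M A F n (fun x' _ => x' < x) s')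
    (by norm_num) (by norm_num) (by norm_num) ?_ (by omega) ⟨?_, ?_, ?_⟩ ?_) (by simp [add_assoc]) ?_
  · simpa [RamState.setReg] using h.size
  · exact ((h.setReg (by norm_num) _).setReg (by norm_num) _).setReg (by norm_num) _
  · intro r hr
    simp [RamState.setReg, show r ≠ 6 by omega, show r ≠ 7 by omega, show r ≠ 8 by omega]
  · refine ⟨?_, by simp, Or.inl ?_⟩ <;> simp [RamState.setReg, two_mul]
  · rintro x hx s₁ ⟨h₁, hr₁, hs₁⟩ h8 -
    refine Runs.mono (Runs.forLoop (n := n) (T := n * 80 + 120) (fun y s' => Heap n M A C F s' ∧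
      (∀ r < 6, s'.reg r = s.reg r) ∧ s'.reg 8 = x ∧
      Selected M A F n (fun x' y' => x' < x ∨ x' = x ∧ y' < y) s')
      (by norm_num) (by norm_num) (by norm_num) h₁.size (by omega) ⟨?_, ?_, ?_, ?_⟩ ?_)
      (by simp [add_assoc]) ?_
    · exact h₁.setReg (by norm_num) _
    · intro r hr
      simpa [RamState.setReg, show r ≠ 9 by omega] using hr₁ r hr
    · simpa [RamState.setReg] using h8
    · exact hs₁.of_reg (fun x' _ y' _ h => by omega) (by simp [RamState.setReg])
        (by simp [RamState.setReg])
    · rintro y hy s₂ ⟨h₂, hr₂, h8, hs₂⟩ h9 -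
      refine Runs.mono (runs_compareProg h₂ hW hs₂ h8 h9 hx hy) le_rfl ?_
      rintro s₃ ⟨h₃, hr₃, h8, h9, hs₃⟩
      refine ⟨h9, h₃.size, h₃.setReg (by norm_num) _, fun r hr => ?_, ?_, ?_⟩
      · simpa [RamState.setReg, show r ≠ 9 by omega] using (hr₃ r hr).trans (hr₂ r hr)
      · simpa [RamState.setReg] using h8
      · exact hs₃.of_reg (fun x' _ y' _ h => by omega) (by simp [RamState.setReg])
          (by simp [RamState.setReg])
    · rintro s₂ ⟨⟨h₂, hr₂, h8', hs₂⟩, -⟩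
      refine ⟨h8', h₂.size, h₂.setReg (by norm_num) _, fun r hr => ?_, ?_⟩
      · simpa [RamState.setReg, show r ≠ 8 by omega] using hr₂ r hr
      · exact hs₂.of_reg (fun x' _ y' hy' h => by omega) (by simp [RamState.setReg])
          (by simp [RamState.setReg])
  · rintro s₁ ⟨⟨h₁, hr₁, -, hle, hs₁⟩, -⟩
    refine ⟨h₁, hr₁, fun hn => ?_⟩
    have hlt := (hle 0 hn 0 hn hn).trans_lt (pairCost_lt h₁ hn hn)
    obtain ⟨h7, y, hy, hc⟩ := hs₁.resolve_left (by omega)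
    exact ⟨h7, y, hy, fun x' hx' y' hy' => hc ▸ hle x' hx' y' hy' hx'⟩

/-- Remove the vertex in the register `7`, and make it the center of its neighbors. -/
def removeProg : RamProg :=
  .seq (storeAt (.aliveAddr (.var 7)) (.lit 0)) (forLoop 8 0 (storeAt (.centerAddr (.var 8))
    (.add (.mul (.mem (.centerAddr (.var 8)))
        (.sub (.lit 1) (.mem (.matrixAddr (.var 8) (.var 7)))))
      (.mul (.var 7) (.mem (.matrixAddr (.var 8) (.var 7)))))))

theorem runs_removeProg {x : ℕ} (h : Heap n M A C F s) (hW : Expr.WordFits W n) (h7 : s.reg 7 = x)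
    (hx : x < n) :
    Runs W removeProg s (n * 80 + 30) fun s' =>
      (∃ C', Heap n M (Function.update A x 0) C' F s' ∧
        ∀ w < n, C' w = if M w x = 1 then x else C w) ∧ ∀ r < 6, s'.reg r = s.reg r := by
  have hW' := hW
  unfold Expr.WordFits at hW'
  have e7 := Expr.Evals.var' (W := W) (by norm_num) h7 (by omega)
  refine Runs.mono (Runs.seq (Runs.storeAt (Q := (· = s.setMem (n * n + x) 0))
    (e7.aliveAddr h hW hx) (.lit 0 (by omega)) rfl) (T' := n * (60 + 12) + 9) ?_) ?_ fun s' hs' => hs'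
  rotate_left
  · simp only [Expr.cost, Expr.aliveAddr]; omega
  intro s₁ hs₁
  have h₁ : Heap n M (Function.update A x 0) C F s₁ := by rw [hs₁]; exact h.setAlive hx (by omega)
  have hr₁ : ∀ r, s₁.reg r = s.reg r := fun r => by rw [hs₁]; rfl
  clear hs₁
  refine Runs.mono (Runs.forLoop (n := n)
    (fun v s' => (∃ C', Heap n M (Function.update A x 0) C' F s' ∧ ∀ w < n, C' w = if w < v ∧ M w x = 1 then x else C w) ∧ ∀ r < 8, s'.reg r = s.reg r)
    (by norm_num) (by norm_num) (by norm_num) h₁.size (by omega) ⟨⟨C, ?_, by simp⟩, ?_⟩ ?_) le_rfl ?_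
  · exact h₁.setReg (by norm_num) _
  · intro r hr
    simpa [RamState.setReg, show r ≠ 8 by omega] using hr₁ r
  · rintro v hv s₂ ⟨⟨C₂, h₂, hC₂⟩, hr₂⟩ h8 -
    have e7 := Expr.Evals.var' (W := W) (by norm_num) ((hr₂ 7 (by norm_num)).trans h7) (by omega)
    have e8 := Expr.Evals.var' (W := W) (by norm_num) h8 (by omega)
    have hMle := h₂.matrix_le v hv x hx
    have hCle := h₂.center_le v hv
    have hval : C₂ v * (1 - M v x) + x * M v x = if M v x = 1 then x else C₂ v := by
      split_ifs with h'
      · simp [h']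
      · have : M v x = 0 := by omega
        simp [this]
    have hle : C₂ v * (1 - M v x) + x * M v x ≤ n := by
      rw [hval]; split_ifs <;> omega
    refine Runs.mono (Runs.storeAt (v := C₂ v * (1 - M v x) + x * M v x) (e8.centerAddr h₂ hW hv)
      (.add (.mul (e8.center h₂ hW hv) (.sub (.lit 1 (by omega)) (e8.matrix e7 h₂ hW hv hx))
        (by omega)) (.mul e7 (e8.matrix e7 h₂ hW hv hx) (by omega)) (by omega)) ?_) (T' := 60) (by decide)
      fun s' h => h
    refine ⟨h8, h₂.size, ⟨_, (h₂.setCenter hv hle).setReg (by norm_num) _, fun w hw => ?_⟩,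
      fun r hr => ?_⟩
    · by_cases hwv : w = v
      · subst hwv
        rw [Function.update_self, hval, hC₂ w hw]
        simp
      · rw [Function.update_of_ne hwv, hC₂ w hw]
        have : w < v ↔ w < v + 1 := by omega
        simp only [this]
    · simpa [RamState.setReg, RamState.setMem, show r ≠ 8 by omega] using hr₂ r hr
  · rintro s₂ ⟨⟨⟨C₂, h₂, hC₂⟩, hr₂⟩, -⟩
    refine ⟨⟨C₂, h₂, fun w hw => ?_⟩, fun r hr => hr₂ r (by omega)⟩
    rw [hC₂ w hw]; simp [hw]

end Programs

/-! ### The program -/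

/-- The indicator of the vertices that are not among `σ 0, …, σ (i - 1)`. -/
def aliveAfter (σ : ℕ → ℕ) (i x : ℕ) : ℕ := open Classical in if ∃ j < i, σ j = x then 0 else 1

/-- The vertices `σ 0, …, σ (i - 1)` have been removed in this order, each of them by an optimal
choice, and `C` records for each vertex which of its neighbors was removed last. -/
structure Removed (M : ℕ → ℕ → ℕ) (n i : ℕ) (σ A C : ℕ → ℕ) : Prop where
  lt : ∀ j < i, σ j < n
  alive : ∀ x < n, A x = aliveAfter σ i x
  optimal : ∀ j < i, ∃ A' F : ℕ → ℕ, (∀ x < n, A' x = aliveAfter σ j x) ∧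
    (∀ w < n, F w = firstRow M A' n w) ∧
    ∃ y < n, ∀ x' < n, ∀ y' < n, pairCost M A' F n (σ j) y ≤ pairCost M A' F n x' y'
  center : ∀ w < n, ∀ j < i, M w (σ j) = 1 → (∀ l < i, j < l → M w (σ l) ≠ 1) → C w = σ j

theorem aliveAfter_update {σ : ℕ → ℕ} {i j : ℕ} (h : j ≤ i) (x y : ℕ) :
    aliveAfter (Function.update σ i x) j y = aliveAfter σ j y := by
  unfold aliveAfter
  have : (∃ l < j, Function.update σ i x l = y) ↔ ∃ l < j, σ l = y :=
    exists_congr fun l => and_congr_right fun hl => by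
      rw [Function.update_of_ne (by omega)]
  simp only [this]

theorem Removed.succ {M : ℕ → ℕ → ℕ} {n i x : ℕ} {σ A C C' F : ℕ → ℕ} (h : Removed M n i σ A C)
    (hx : x < n) (hF : ∀ w < n, F w = firstRow M A n w)
    (hopt : ∃ y < n, ∀ x' < n, ∀ y' < n, pairCost M A F n x y ≤ pairCost M A F n x' y')
    (hC : ∀ w < n, C' w = if M w x = 1 then x else C w) :
    Removed M n (i + 1) (Function.update σ i x) (Function.update A x 0) C' := by
  have hσ : ∀ j < i, Function.update σ i x j = σ j := fun j hj =>
    Function.update_of_ne (by omega) _ _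
  refine ⟨fun j hj => ?_, fun y hy => ?_, fun j hj => ?_, fun w hw j hj hM hlast => ?_⟩
  · rcases Nat.lt_succ_iff_lt_or_eq.1 hj with hj | rfl
    · rw [hσ j hj]; exact h.lt j hj
    · simpa using hx
  · by_cases hyx : y = x
    · subst hyx
      have : ∃ j < i + 1, Function.update σ i y j = y := ⟨i, by omega, by simp⟩
      rw [Function.update_self, aliveAfter, if_pos this]
    · rw [Function.update_of_ne hyx, h.alive y hy]
      unfold aliveAfter
      have : (∃ l < i + 1, Function.update σ i x l = y) ↔ ∃ l < i, σ l = y := by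
        constructor
        · rintro ⟨l, hl, rfl⟩
          rcases Nat.lt_succ_iff_lt_or_eq.1 hl with hl | rfl
          · exact ⟨l, hl, (hσ l hl).symm⟩
          · simp at hyx
        · rintro ⟨l, hl, rfl⟩
          exact ⟨l, by omega, hσ l hl⟩
      simp only [this]
  · rcases Nat.lt_succ_iff_lt_or_eq.1 hj with hj | rfl
    · obtain ⟨A', F', hA', hF', hopt'⟩ := h.optimal j hj
      refine ⟨A', F', fun y hy => ?_, hF', ?_⟩
      · rw [aliveAfter_update hj.le, hA' y hy]
      · rw [hσ j hj]; exact hopt'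
    · refine ⟨A, F, fun y hy => ?_, hF, ?_⟩
      · rw [aliveAfter_update le_rfl, h.alive y hy]
      · rw [Function.update_self]; exact hopt
  · rw [hC w hw]
    rcases Nat.lt_succ_iff_lt_or_eq.1 hj with hj | rfl
    · have hi := hlast i (by omega) hj
      rw [Function.update_self] at hi
      rw [if_neg hi, hσ j hj]
      rw [hσ j hj] at hM
      refine h.center w hw j hj hM fun l hl hjl => ?_
      rw [← hσ l hl]
      exact hlast l (by omega) hjl
    · rw [Function.update_self] at hM ⊢
      rw [if_pos hM]

section Programs

variable {W n : ℕ} {M : ℕ → ℕ → ℕ} {A C F : ℕ → ℕ} {s : RamState}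

/-- Put ones on the diagonal of the matrix, and declare all vertices alive. -/
def initProg : RamProg :=
  forLoop 5 0 (.seq (storeAt (.matrixAddr (.var 5) (.var 5)) (.lit 1))
    (storeAt (.aliveAddr (.var 5)) (.lit 1)))

theorem runs_initProg (h : Heap n M (fun _ => 0) C F s) (hW : Expr.WordFits W n) :
    Runs W initProg s (n * 60 + 9) fun s' => ∃ M' A', Heap n M' A' C F s' ∧
      (∀ i < n, ∀ j < n, M' i j = if i = j then 1 else M i j) ∧ ∀ i < n, A' i = 1 := by
  have hW' := hW
  unfold Expr.WordFits at hW'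
  refine Runs.mono (Runs.forLoop (n := n) (T := 48) (fun v s' => ∃ M' A', Heap n M' A' C F s' ∧
    (∀ i < n, ∀ j < n, M' i j = if i = j ∧ i < v then 1 else M i j) ∧
    ∀ i < n, A' i = if i < v then 1 else 0)
    (by norm_num) (by norm_num) (by norm_num) h.size (by omega)
    ⟨M, _, h.setReg (by norm_num) _, by simp, by simp⟩ ?_) (by omega) ?_
  · rintro v hv s₁ ⟨M₁, A₁, h₁, hM₁, hA₁⟩ h5 -
    have e5 := Expr.Evals.var' (W := W) (by norm_num) h5 (by omega)
    refine Runs.mono (Runs.seq (T' := 24) (Runs.storeAt (Q := (· = s₁.setMem (v * n + v) 1))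
      (e5.matrixAddr e5 h₁ hW hv hv) (.lit 1 (by omega)) rfl) ?_) (by decide) fun s' h => h
    intro s₂ hs₂
    have h₂ : Heap n (Function.update M₁ v (Function.update (M₁ v) v 1)) A₁ C F s₂ := by
      rw [hs₂]; exact h₁.setMatrix hv hv le_rfl
    have h5' : s₂.reg 5 = v := by rw [hs₂]; exact h5
    clear hs₂
    have e5 := Expr.Evals.var' (W := W) (by norm_num) h5' (by omega)
    refine Runs.mono (Runs.storeAt (e5.aliveAddr h₂ hW hv) (.lit 1 (by omega)) ?_) (by decide)
      fun s' h => h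
    refine ⟨h5', h₂.size, _, _, (h₂.setAlive hv le_rfl).setReg (by norm_num) _,
      fun i hi j hj => ?_, fun i hi => ?_⟩
    · by_cases hiv : i = v
      · subst hiv
        by_cases hij : j = i
        · subst hij; simp
        · simp [hij, hM₁ i hi j hj, Ne.symm hij]
      · rw [Function.update_of_ne hiv, hM₁ i hi j hj]
        have : i < v ↔ i < v + 1 := by omega
        simp only [this]
    · by_cases hiv : i = v
      · subst hiv; simp
      · rw [Function.update_of_ne hiv, hA₁ i hi]
        have : i < v ↔ i < v + 1 := by omega
        simp only [this]
  · rintro s₁ ⟨⟨M₁, A₁, h₁, hM₁, hA₁⟩, -⟩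
    refine ⟨M₁, A₁, h₁, fun i hi j hj => ?_, fun i hi => ?_⟩
    · rw [hM₁ i hi j hj]; simp [hi]
    · rw [hA₁ i hi, if_pos hi]

/-- Remove all vertices, one after the other. -/
def removeAllProg : RamProg := forLoop 5 0 (.seq firstProg (.seq selectProg removeProg))

theorem runs_removeAllProg (h : Heap n M A C F s) (hA : ∀ i < n, A i = 1)
    (hW : Expr.WordFits W n) :
    Runs W removeAllProg s (n * (n * (n * (n * 160 + 190) + 170) + 100) + 9) fun s' =>
      ∃ σ A' C' F', Heap n M A' C' F' s' ∧ Removed M n n σ A' C' := by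
  have hW' := hW
  unfold Expr.WordFits at hW'
  refine Runs.mono (Runs.forLoop (n := n) (T := n * (n * (n * 160 + 190) + 170) + 80)
    (fun i s' => ∃ σ A' C' F', Heap n M A' C' F' s' ∧ Removed M n i σ A' C')
    (by norm_num) (by norm_num) (by norm_num) h.size (by omega)
    ⟨fun _ => 0, A, C, F, h.setReg (by norm_num) _, ?_⟩ ?_) (by rw [add_assoc]; gcongr; omega)
    fun s' hs' => hs'.1
  · exact ⟨by simp, fun x hx => by simp [aliveAfter, hA x hx], by simp, by simp⟩
  · rintro i hi s₁ ⟨σ, A₁, C₁, F₁, h₁, hσ⟩ h5 -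
    refine Runs.mono (Runs.seq (runs_firstProg h₁ hW)
      (T' := (n * (n * (n * 80 + 150) + 30) + 30) + (n * 80 + 30)) ?_) ?_ fun s' h => h
    rotate_left
    · ring_nf; omega
    rintro s₂ ⟨F₂, h₂, hF₂, hr₂⟩
    refine Runs.seq (runs_selectProg h₂ hW) ?_
    rintro s₃ ⟨h₃, hr₃, hsel⟩
    obtain ⟨h7, hopt⟩ := hsel (by omega)
    refine Runs.mono (runs_removeProg h₃ hW rfl h7) le_rfl ?_
    rintro s₄ ⟨⟨C₄, h₄, hC₄⟩, hr₄⟩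
    refine ⟨?_, h₄.size, _, _, C₄, F₂, h₄.setReg (by norm_num) _, hσ.succ h7 hF₂ hopt hC₄⟩
    rw [hr₄ 5 (by norm_num), hr₃ 5 (by norm_num), hr₂ 5 (by norm_num), h5]

/-- The output at position `b` of the characteristic vector for `a`. -/
def outVal (M : ℕ → ℕ → ℕ) (C : ℕ → ℕ) (n a b : ℕ) : ℕ :=
  1 - (1 - ∑ w ∈ range n, M b w * (1 - adiff (C w) (C a)))

theorem outVal_eq_one_iff (h : Heap n M A C F s) {a b : ℕ} (hb : b < n) :
    outVal M C n a b = 1 ↔ ∃ w < n, M b w = 1 ∧ C w = C a := by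
  have hM := h.matrix_le b hb
  have h₁ : outVal M C n a b = 1 ↔ ∑ w ∈ range n, M b w * (1 - adiff (C w) (C a)) ≠ 0 := by
    unfold outVal; omega
  rw [h₁, Ne, sum_eq_zero_iff]
  push Not
  refine exists_congr fun w => ?_
  rw [mem_range]
  refine and_congr_right fun hw => ?_
  have := hM w hw
  rw [mul_ne_zero_iff]
  unfold adiff
  omega

/-- Write the clusters: the cluster number `a` consists of the neighbors of the vertices that have
the same center as `a`. -/
def outProg : RamProg :=
  .seq (assign 1 .outAddr) (forLoop 5 0 (forLoop 6 0 (.seq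
    (sumLoop 8 7 (.mul (.mem (.matrixAddr (.var 6) (.var 8)))
      (.sub (.lit 1) (.dist (.mem (.centerAddr (.var 8))) (.mem (.centerAddr (.var 5)))))))
    (storeAt (.add (.var 1) (.add (.mul (.var 5) (.var 0)) (.var 6)))
      (.sub (.lit 1) (.sub (.lit 1) (.var 7)))))))

theorem runs_outProg (h : Heap n M A C F s) (hW : Expr.WordFits W n) :
    Runs W outProg s (n * (n * (n * 80 + 80) + 30) + 60) fun s' => s'.reg 0 = n ∧
      ∀ a < n, ∀ b < n, s'.mem (s'.reg 1 + (a * n + b)) = outVal M C n a b := by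
  have hW' := hW
  unfold Expr.WordFits at hW'
  set base := n * n + n + n + n with hbase
  refine Runs.mono (Runs.seq (Runs.assign (Q := (· = s.setReg 1 base)) (.outAddr h hW)
    (by norm_num) rfl) (T' := n * (n * (n * 80 + 80) + 21) + 9) ?_) ?_ fun s' h => h
  rotate_left
  · simp only [Expr.cost, Expr.outAddr]
    have : n * (n * (n * 80 + 80) + 21) ≤ n * (n * (n * 80 + 80) + 30) := by gcongr; omega
    omega
  rintro _ rfl
  have inner : ∀ a < n, ∀ b < n, ∀ s₂, Heap n M A C F s₂ → s₂.reg 1 = base → s₂.reg 5 = a →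
      s₂.reg 6 = b → Runs W (.seq
    (sumLoop 8 7 (.mul (.mem (.matrixAddr (.var 6) (.var 8)))
      (.sub (.lit 1) (.dist (.mem (.centerAddr (.var 8))) (.mem (.centerAddr (.var 5)))))))
    (storeAt (.add (.var 1) (.add (.mul (.var 5) (.var 0)) (.var 6)))
      (.sub (.lit 1) (.sub (.lit 1) (.var 7))))) s₂ (n * 80 + 68) fun s' => Heap n M A C F s' ∧
        (∀ r < 7, s'.reg r = s₂.reg r) ∧
        s'.mem = Function.update s₂.mem (base + (a * n + b)) (outVal M C n a b) := by
    intro a ha b hb s₂ h₂ h1 h5 h6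
    have hterm : ∀ w < n, M b w * (1 - adiff (C w) (C a)) ≤ 1 := fun w hw =>
      Nat.mul_le_mul (h.matrix_le b hb w hw) (Nat.sub_le _ _)
    have hsum : ∑ w ∈ range n, M b w * (1 - adiff (C w) (C a)) ≤ n := by
      calc _ ≤ ∑ w ∈ range n, 1 := sum_le_sum fun w hw => hterm w (mem_range.1 hw)
        _ = n := by simp
    refine Runs.mono (Runs.seq (T' := 50) (Runs.sumLoop (n := n)
      (fun w => M b w * (1 - adiff (C w) (C a))) (by norm_num) (by norm_num) (by norm_num)
      (by norm_num) (by norm_num) h₂.size (by omega) (by omega) fun w hw v => ?_) ?_) ?_ fun s' h => h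
    · have h' := (h₂.setReg (r := 7) (by norm_num) v).setReg (r := 8) (by norm_num) w
      have e8 : Expr.Evals W ((s₂.setReg 7 v).setReg 8 w) (.var 8) w :=
        .var' (by norm_num) (by simp [RamState.setReg]) (by omega)
      have e6 : Expr.Evals W ((s₂.setReg 7 v).setReg 8 w) (.var 6) b :=
        .var' (by norm_num) (by simpa [RamState.setReg] using h6) (by omega)
      have e5 : Expr.Evals W ((s₂.setReg 7 v).setReg 8 w) (.var 5) a :=
        .var' (by norm_num) (by simpa [RamState.setReg] using h5) (by omega)
      have := hterm w hw
      exact .mul (e6.matrix e8 h' hW hb hw) (.sub (.lit 1 (by omega))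
        (.dist (e8.center h' hW hw) (e5.center h' hW ha))) (by omega)
    · intro s₃ hs₃
      have h₃ : Heap n M A C F s₃ := by
        rw [hs₃]; exact (h₂.setReg (by norm_num) _).setReg (by norm_num) _
      have hr₃ : ∀ r < 7, s₃.reg r = s₂.reg r := fun r hr => by
        simp [hs₃, RamState.setReg, show r ≠ 7 by omega, show r ≠ 8 by omega]
      have h7 : s₃.reg 7 = ∑ w ∈ range n, M b w * (1 - adiff (C w) (C a)) := by
        simp [hs₃, RamState.setReg]
      have hm : s₃.mem = s₂.mem := by simp [hs₃, RamState.setReg]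
      clear hs₃
      have hab := index_lt ha hb
      have e1 : Expr.Evals W s₃ (.var 1) base :=
        .var' (by norm_num) ((hr₃ 1 (by norm_num)).trans h1) (by omega)
      have e5 : Expr.Evals W s₃ (.var 5) a :=
        .var' (by norm_num) ((hr₃ 5 (by norm_num)).trans h5) (by omega)
      have e6 : Expr.Evals W s₃ (.var 6) b :=
        .var' (by norm_num) ((hr₃ 6 (by norm_num)).trans h6) (by omega)
      refine Runs.mono (Runs.storeAt (v := outVal M C n a b) (.add e1 (e5.matrixAddr e6 h₃ hW ha hb)
        (by omega)) (.sub (.lit 1 (by omega)) (.sub (.lit 1 (by omega))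
          (.var' (by norm_num) h7 (by omega)))) ?_) (by decide) fun s' h => h
      refine ⟨h₃.setOutput (by omega) _, hr₃, ?_⟩
      simp [RamState.setMem, hm]
    · have h₁ : ∀ c ≤ 63, n * (c + 17) ≤ n * 80 := fun c hc => Nat.mul_le_mul_left _ (by omega)
      refine le_trans (Nat.add_le_add_right (Nat.add_le_add_right (h₁ _ (by decide)) _) _) (by omega)
  refine Runs.mono (Runs.forLoop (n := n) (T := n * (n * 80 + 80) + 9)
    (fun a s' => Heap n M A C F s' ∧ s'.reg 1 = base ∧
      ∀ a' < n, ∀ b' < n, a' < a → s'.mem (base + (a' * n + b')) = outVal M C n a' b')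
    (by norm_num) (by norm_num) (by norm_num) ?_ (by omega) ⟨?_, ?_, ?_⟩ ?_) (by simp [add_assoc]) ?_
  · simpa [RamState.setReg] using h.size
  · exact (h.setReg (by norm_num) _).setReg (by norm_num) _
  · simp [RamState.setReg]
  · simp
  · rintro a ha s₁ ⟨h₁, h1, hout⟩ h5 -
    refine Runs.mono (Runs.forLoop (n := n) (T := n * 80 + 68)
      (fun b s' => Heap n M A C F s' ∧ s'.reg 1 = base ∧ s'.reg 5 = a ∧
        ∀ a' < n, ∀ b' < n, a' < a ∨ a' = a ∧ b' < b →
          s'.mem (base + (a' * n + b')) = outVal M C n a' b')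
      (by norm_num) (by norm_num) (by norm_num) h₁.size (by omega) ⟨?_, ?_, ?_, ?_⟩ ?_)
      (by simp [add_assoc]) ?_
    · exact h₁.setReg (by norm_num) _
    · simpa [RamState.setReg] using h1
    · simpa [RamState.setReg] using h5
    · intro a' ha' b' hb' h'
      exact hout a' ha' b' hb' (by omega)
    · rintro b hb s₂ ⟨h₂, h1, h5, hout⟩ h6 -
      refine Runs.mono (inner a ha b hb s₂ h₂ h1 h5 h6) le_rfl ?_
      rintro s₃ ⟨h₃, hr₃, hm⟩
      refine ⟨(hr₃ 6 (by norm_num)).trans h6, h₃.size, h₃.setReg (by norm_num) _, ?_, ?_, ?_⟩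
      · simpa [RamState.setReg] using (hr₃ 1 (by norm_num)).trans h1
      · simpa [RamState.setReg] using (hr₃ 5 (by norm_num)).trans h5
      · intro a' ha' b' hb' h'
        simp only [RamState.setReg, hm]
        by_cases hab : base + (a' * n + b') = base + (a * n + b)
        · obtain ⟨rfl, rfl⟩ := index_inj hb' hb (Nat.add_left_cancel hab)
          rw [Function.update_self]
        · rw [Function.update_of_ne hab]
          refine hout a' ha' b' hb' ?_
          by_contra hcon
          obtain ⟨rfl, rfl⟩ : a' = a ∧ b' = b := by omega
          exact hab rfl
    · rintro s₂ ⟨⟨h₂, h1, h5, hout⟩, -⟩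
      refine ⟨h5, h₂.size, h₂.setReg (by norm_num) _, by simpa [RamState.setReg] using h1, ?_⟩
      intro a' ha' b' hb' h'
      exact hout a' ha' b' hb' (by omega)
  · rintro s₁ ⟨⟨h₁, h1, hout⟩, -⟩
    refine ⟨h₁.size, fun a ha b hb => ?_⟩
    rw [h1]
    exact hout a ha b hb ha

/-- The program that computes the cover. -/
def coverProg : RamProg := .seq initProg (.seq removeAllProg outProg)

theorem runs_coverProg (h : Heap n M (fun _ => 0) C F s) (hW : Expr.WordFits W n) :
    Runs W coverProg s (1200 * (n ^ 4 + 1)) fun s' => s'.reg 0 = n ∧ ∃ M' σ A' C',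
      (∀ i < n, ∀ j < n, M' i j = if i = j then 1 else M i j) ∧ Removed M' n n σ A' C' ∧
      ∀ a < n, ∀ b < n, s'.mem (s'.reg 1 + (a * n + b)) = 1 ↔ ∃ w < n, M' b w = 1 ∧ C' w = C' a := by
  refine Runs.mono (Runs.seq (runs_initProg h hW)
    (T' := (n * (n * (n * (n * 160 + 190) + 170) + 100) + 9) + (n * (n * (n * 80 + 80) + 30) + 60))
      ?_) ?_ fun s' h => h
  · rintro s₁ ⟨M', A₁, h₁, hM', hA₁⟩
    refine Runs.seq (runs_removeAllProg h₁ hA₁ hW) ?_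
    rintro s₂ ⟨σ, A₂, C₂, F₂, h₂, hσ⟩
    refine Runs.mono (runs_outProg h₂ hW) le_rfl ?_
    rintro s₃ ⟨h0, hout⟩
    refine ⟨h0, M', σ, A₂, C₂, hM', hσ, fun a ha b hb => ?_⟩
    rw [hout a ha b hb, outVal_eq_one_iff h₂ hb]
  · have h1 : n ≤ n ^ 4 := Nat.le_self_pow (by norm_num) n
    have h2 : n ^ 2 ≤ n ^ 4 := by
      have := Nat.le_self_pow (n := 2) (by norm_num) (n ^ 2)
      calc n ^ 2 ≤ (n ^ 2) ^ 2 := this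
        _ = n ^ 4 := by ring
    have h3 : n ^ 3 ≤ n ^ 4 := by
      rcases Nat.eq_zero_or_pos n with rfl | hn
      · simp
      · exact Nat.pow_le_pow_right hn (by norm_num)
    ring_nf
    omega

end Programs

/-! ### Correctness of the elimination order -/

section Correctness

variable {V : Type*} [Fintype V] {r : V → V → Prop} [∀ x, DecidablePred (r x)]
  {n : ℕ} (e : V ≃ Fin n) {M : ℕ → ℕ → ℕ} {A F : ℕ → ℕ}

theorem rowDist_eq_card {B : ℕ → ℕ} (hM : ∀ x y, M (e x) (e y) = if r x y then 1 else 0)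
    (hB : ∀ w < n, B w ≤ 1) (x y : V) :
    rowDist M B n (e x) (e y) = #{w ∈ {w | B (e w) = 1} | ¬(r x w ↔ r y w)} := by
  rw [rowDist, sum_range, ← e.sum_comp, filter_filter, card_filter]
  refine sum_congr rfl fun w _ => ?_
  have := hB (e w) (e w).2
  rw [hM, hM]
  have hB : B (e w) = 0 ∨ B (e w) = 1 := by omega
  rcases hB with h | h <;> by_cases h₁ : r x w <;> by_cases h₂ : r y w <;> simp [h, h₁, h₂, adiff]

theorem firstRow_eq_one_iff (hM : ∀ x y, M (e x) (e y) = if r x y then 1 else 0)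
    (hA : ∀ x < n, A x ≤ 1) (w : V) :
    firstRow M A n (e w) = 1 ↔
      ∀ w', e w' < e w → ¬ ∀ x, A (e x) = 1 → (r w x ↔ r w' x) := by
  have h₁ : firstRow M A n (e w) = 1 ↔ ∀ w' < (e w : ℕ), rowDist M A n (e w) w' ≠ 0 := by
    unfold firstRow
    split_ifs with h
    · exact iff_of_true rfl h
    · exact iff_of_false (by norm_num) h
  have h₂ : ∀ w', rowDist M A n (e w) (e w') ≠ 0 ↔
      ¬ ∀ x, A (e x) = 1 → (r w x ↔ r w' x) := fun w' => by
    rw [rowDist_eq_card e hM hA, Ne, card_eq_zero, filter_eq_empty_iff]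
    simp
  rw [h₁]
  constructor
  · intro h w' hw'
    exact (h₂ w').1 (h _ hw')
  · intro h w' hw'
    have hlt : w' < n := hw'.trans (e w).2
    have := (h₂ (e.symm ⟨w', hlt⟩)).2 (h _ (by rw [Equiv.apply_symm_apply]; exact hw'))
    simpa using this

/-- A pair of least cost consists of alive vertices, and is a pair of distinct vertices separated by as
few representatives as possible if at least two vertices are alive. -/
theorem optimal_pair (hM : ∀ i < n, ∀ j < n, M i j ≤ 1) (hA : ∀ x < n, A x ≤ 1)
    (hF : ∀ x < n, F x ≤ 1) {x y x₀ : ℕ} (hx : x < n) (hy : y < n)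
    (hopt : ∀ x' < n, ∀ y' < n, pairCost M A F n x y ≤ pairCost M A F n x' y')
    (hx₀ : x₀ < n) (hAx₀ : A x₀ = 1) :
    A x = 1 ∧ A y = 1 ∧ ∀ x₁ < n, ∀ x₂ < n, x₁ ≠ x₂ → A x₁ = 1 → A x₂ = 1 →
      x ≠ y ∧ rowDist M F n x y ≤ rowDist M F n x₁ x₂ := by
  have h₀ := hopt x₀ hx₀ x₀ hx₀
  have h₀' : pairCost M A F n x₀ x₀ = n + 1 := by
    have : rowDist M F n x₀ x₀ = 0 := sum_eq_zero fun k _ => by simp [adiff]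
    simp [pairCost, this, hAx₀, adiff]
  rw [h₀'] at h₀
  have hAx := hA x hx
  have hAy := hA y hy
  have hboth : A x = 1 ∧ A y = 1 := by
    by_contra hcon
    have : A x * A y = 0 := by
      rw [mul_eq_zero]; omega
    simp only [pairCost, this] at h₀
    omega
  refine ⟨hboth.1, hboth.2, fun x₁ hx₁ x₂ hx₂ hne hA₁ hA₂ => ?_⟩
  have h₁ := hopt x₁ hx₁ x₂ hx₂
  have hd := rowDist_le hM hx₁ hx₂ hF
  have hdiff : 1 - adiff x₁ x₂ = 0 := by unfold adiff; omega
  simp only [pairCost, hboth.1, hboth.2, hA₁, hA₂, hdiff] at h₁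
  refine ⟨?_, by omega⟩
  rintro rfl
  simp [adiff] at h₁
  omega

/-- The vertex that is removed next has a near-twin among the alive vertices, unless it is the only
alive vertex. -/
theorem Removed.exists_twin [DecidableEq V] {c i j : ℕ} {σ C : ℕ → ℕ} (hr : LinearTraces r c)
    (hsymm : ∀ x y, r x y → r y x) (hM : ∀ x y, M (e x) (e y) = if r x y then 1 else 0)
    (h : Removed M n i σ A C) (hj : j < i) (hjn : j < n) :
    aliveAfter σ j (σ j) = 1 ∧ ∀ v : V, (e v : ℕ) = σ j →
      (∀ x, aliveAfter σ j (e x) = 1 → x = v) ∨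
      ∃ p, p ≠ v ∧ aliveAfter σ j (e p) = 1 ∧ ∃ F : Finset V,
        (∀ w, ∃ w' ∈ F, ∀ x, aliveAfter σ j (e x) = 1 → (r w x ↔ r w' x)) ∧
        #{w ∈ F | ¬(r w v ↔ r w p)} ≤ twinBound c := by
  obtain ⟨A', F, hA', hF, y, hy, hopt⟩ := h.optimal j hj
  have hsymm' : ∀ x y, r x y ↔ r y x := fun x y => ⟨hsymm x y, hsymm y x⟩
  have hMle : ∀ i < n, ∀ j < n, M i j ≤ 1 := fun i hi j hj => by
    have := hM (e.symm ⟨i, hi⟩) (e.symm ⟨j, hj⟩)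
    simp only [Equiv.apply_symm_apply] at this
    rw [this]; split_ifs <;> omega
  have hAle : ∀ x < n, A' x ≤ 1 := fun x hx => by
    rw [hA' x hx]; unfold aliveAfter; split_ifs <;> omega
  have hFle : ∀ x < n, F x ≤ 1 := fun x hx => by
    rw [hF x hx]; unfold firstRow; split_ifs <;> omega
  obtain ⟨x₀, hx₀, hAx₀⟩ : ∃ x₀ < n, A' x₀ = 1 := by
    -- fewer than `n` vertices have been removed
    have hcard : #((range j).image σ) < #(range n) := by
      rw [card_range]; exact card_image_le.trans_lt (by simpa using hjn)
    obtain ⟨x₀, hx₀, hnot⟩ := exists_mem_notMem_of_card_lt_card hcard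
    rw [mem_range] at hx₀
    refine ⟨x₀, hx₀, ?_⟩
    rw [hA' x₀ hx₀, aliveAfter, if_neg]
    rintro ⟨l, hl, rfl⟩
    exact hnot (mem_image_of_mem _ (mem_range.2 hl))
  obtain ⟨h₁, h₂, h₃⟩ := optimal_pair hMle hAle hFle (h.lt j hj) hy hopt hx₀ hAx₀
  refine ⟨by rw [← hA' _ (h.lt j hj), h₁], fun v hv => ?_⟩
  have hA'' : ∀ x, aliveAfter σ j (e x) = A' (e x) := fun x => (hA' _ (e x).2).symm
  simp only [hA'']
  rw [or_iff_not_imp_left]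
  intro hmore
  push Not at hmore
  obtain ⟨z, hz, hzv⟩ := hmore
  have hFone : ∀ w, F (e w) = 1 ↔ ∀ w', e w' < e w → ¬ ∀ x, A' (e x) = 1 → (r w x ↔ r w' x) :=
    fun w => by rw [hF _ (e w).2, firstRow_eq_one_iff e hM hAle]
  obtain ⟨x, hx, x', hx', hne, htwin⟩ := hr.exists_near_twins ({x | A' (e x) = 1} : Finset V)
    ({w | F (e w) = 1} : Finset V)
    (one_lt_card.2 ⟨z, by simpa using hz, v, by simpa [hv] using h₁, hzv⟩) (by
      intro w hw w' hw' hsame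
      simp only [mem_filter, mem_univ, true_and] at hw hw' hsame
      rw [hFone] at hw hw'
      by_contra hne
      rcases lt_or_gt_of_ne (fun h => hne (e.injective h)) with hlt | hlt
      · exact hw' w hlt fun x hx => (hsame x hx).symm
      · exact hw w' hlt hsame)
  simp only [mem_filter, mem_univ, true_and] at hx hx'
  obtain ⟨hxy, hle⟩ := h₃ (e x) (e x).2 (e x') (e x').2
    (fun h => hne (e.injective (Fin.ext h))) hx hx'
  have hey : (e (e.symm ⟨y, hy⟩) : ℕ) = y := by simp
  refine ⟨e.symm ⟨y, hy⟩, fun h => hxy ?_, by rw [hey]; exact h₂,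
    ({w | F (e w) = 1} : Finset V), fun w => ?_, ?_⟩
  · rw [← hv, ← h, hey]
  · obtain ⟨w', hw', hmin⟩ := exists_min_image
      ({w' | ∀ x, A' (e x) = 1 → (r w x ↔ r w' x)} : Finset V) e ⟨w, by simp⟩
    simp only [mem_filter, mem_univ, true_and] at hw' hmin ⊢
    refine ⟨w', (hFone w').2 fun w'' hlt hsame => ?_, hw'⟩
    exact absurd (hmin w'' fun x hx => (hw' x hx).trans (hsame x hx)) (not_le.2 hlt)
  · rw [rowDist_eq_card e hM hFle] at hle
    nth_rewrite 1 [← hv, ← hey] at hle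
    rw [rowDist_eq_card e hM hFle] at hle
    refine le_trans (le_of_eq ?_) (hle.trans htwin)
    congr 1
    refine filter_congr fun w _ => ?_
    rw [hsymm' w v, hsymm' w _]

/-- Once all vertices have been removed, the array `C` holds a map `f` that sends each vertex to one of
its neighbors or itself, and takes boundedly many values on each neighborhood. -/
theorem Removed.exists_center [DecidableEq V] {c h : ℕ} {σ C : ℕ → ℕ} (hr : LinearTraces r c)
    (hh : NoHalfGraph r h) (hrefl : ∀ x, r x x) (hsymm : ∀ x y, r x y → r y x)
    (hM : ∀ x y, M (e x) (e y) = if r x y then 1 else 0) (hσ : Removed M n n σ A C) :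
    ∃ f : V → V, (∀ w, (e (f w) : ℕ) = C (e w)) ∧ (∀ w, r w (f w)) ∧
      ∀ v, #(image f {w | r w v}) ≤ walkBound (twinBound c) (treeDepth (h + (h + 1))) := by
  have hinj : ∀ j < n, ∀ l < j, σ l ≠ σ j := fun j hj l hl heq => by
    have := (hσ.exists_twin e hr hsymm hM hj hj).1
    rw [aliveAfter, if_pos ⟨l, hl, heq⟩] at this
    exact absurd this (by norm_num)
  have hsurj : ∀ x : V, ∃ j : Fin n, σ j = e x := by
    have hi : Function.Injective fun j : Fin n => (⟨σ j, hσ.lt j j.2⟩ : Fin n) := by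
      intro j l hjl
      have hjl : σ j = σ l := congrArg Fin.val hjl
      rcases lt_trichotomy j l with h | h | h
      · exact absurd hjl (hinj l l.2 j h)
      · exact h
      · exact absurd hjl.symm (hinj j j.2 l h)
    intro x
    obtain ⟨j, hj⟩ := Finite.surjective_of_injective hi (e x)
    exact ⟨j, congrArg Fin.val hj⟩
  -- `t x` is the time when `x` is removed; the order to consider is the reverse of the removal order
  choose t ht using hsurj
  have halive : ∀ j x, aliveAfter σ j (e x) = 1 ↔ j ≤ t x := fun j x => by
    unfold aliveAfter
    split_ifs with h'
    · obtain ⟨l, hl, hlx⟩ := h'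
      have : ¬ j ≤ t x := fun hle => hinj (t x) (t x).2 l (by omega) (by rw [hlx, ht])
      simp [this]
    · simp only [true_iff]
      by_contra! hlt
      exact h' ⟨t x, hlt, ht x⟩
  have htinj : ∀ x y, t x = t y → x = y := fun x y hxy =>
    e.injective (Fin.ext (by rw [← ht x, ← ht y, hxy]))
  have htwin : ∀ v, ∃ p, (∀ x, (t x : ℕ) ≤ t v) ∨ (t v : ℕ) < t p ∧ ∃ F : Finset V,
      (∀ w, ∃ w' ∈ F, ∀ x, (t v : ℕ) ≤ t x → (r w x ↔ r w' x)) ∧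
      #{w ∈ F | ¬(r w v ↔ r w p)} ≤ twinBound c := fun v => by
    have := (hσ.exists_twin e hr hsymm hM (t v).2 (t v).2).2 v (ht v).symm
    simp only [halive] at this
    rcases this with h' | ⟨p, hpv, hp, hF⟩
    · refine ⟨v, Or.inl fun x => ?_⟩
      by_contra! hlt
      exact absurd (congrArg t (h' x hlt.le)) (fun h => by rw [h] at hlt; exact lt_irrefl _ hlt)
    · exact ⟨p, Or.inr ⟨lt_of_le_of_ne hp fun h => hpv (htinj _ _ (Fin.ext h.symm)), hF⟩⟩
  choose p hp using htwin
  have hlast : ∀ w, ∃ x, r w x ∧ ∀ y, r w y → (t y : ℕ) ≤ t x := fun w => by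
    obtain ⟨x, hx, hmax⟩ := exists_max_image ({x | r w x} : Finset V) t ⟨w, by simpa using hrefl w⟩
    exact ⟨x, by simpa using hx, fun y hy => hmax y (by simpa using hy)⟩
  choose f hf hmax using hlast
  refine ⟨f, fun w => ?_, hf, ?_⟩
  · rw [← ht (f w)]
    refine (hσ.center (e w) (e w).2 (t (f w)) (t (f w)).2 ?_ fun l hl hlt hone => ?_).symm
    · rw [ht, hM, if_pos (hf w)]
    · have hel : (e (e.symm ⟨σ l, hσ.lt l hl⟩) : ℕ) = σ l := by simp
      rw [← hel, hM] at hone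
      have hrw : r w (e.symm ⟨σ l, hσ.lt l hl⟩) := by
        by_contra h'
        rw [if_neg h'] at hone
        exact absurd hone (by norm_num)
      have h₁ := hmax w _ hrw
      have h₂ := ht (e.symm ⟨σ l, hσ.lt l hl⟩)
      rw [hel] at h₂
      exact hinj l hl _ (by omega) h₂
  · refine card_image_center_le r hh (fun x => n - t x) (fun x y hxy => htinj x y (Fin.ext ?_)) p
      (fun v => ?_) f hf fun w x hx => ?_
    · have := (t x).2
      have := (t y).2
      simp only at hxy
      omega
    · rcases hp v with h' | ⟨hlt, F, hF, hFc⟩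
      · exact Or.inl fun x => by have := h' x; omega
      · refine Or.inr ⟨by have := (t (p v)).2; omega, F, fun w => ?_, hFc⟩
        obtain ⟨w', hw', hsame⟩ := hF w
        refine ⟨w', hw', fun x hx => hsame x ?_⟩
        have := (t x).2
        have := (t v).2
        omega
    · have := hmax w x hx
      omega

end Correctness

/-! ### Transductions -/

/-- The transduction that returns a graph and its induced subgraphs. -/
def idTransduction : Transduction where
  copies := 1
  colors := 0
  formula := FirstOrder.Language.Relations.formula₂ (L := copyLang 0) CopyRel.adj
    (FirstOrder.Language.Term.var 0) (FirstOrder.Language.Term.var 1)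

theorem realize_idTransduction {V : Type} (G : SimpleGraph V) (M : Fin 0 → Set (V × Fin 1)) (u v : V) :
    @FirstOrder.Language.Formula.Realize (copyLang 0) (V × Fin 1) (coloredCopy G 1 M) (Fin 2)
      idTransduction.formula ![(u, 0), (v, 0)] ↔ G.Adj u v := by
  let := coloredCopy G 1 M
  refine FirstOrder.Language.Formula.realize_rel₂.trans ?_
  change ((0 : Fin 1) = 0 ∧ G.Adj u v) ↔ _
  simp

theorem mem_image_idTransduction {C : Set FinGraph} {G : FinGraph} (hG : G ∈ C) :
    G ∈ idTransduction.image C := by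
  have hinj : Function.Injective fun v : G.V => ((v, 0) : G.V × Fin 1) :=
    fun u v h => congrArg Prod.fst h
  refine Set.mem_iUnion₂.2 ⟨G, hG, fun _ => ∅, ⟨⟨⟨_, hinj⟩, fun {u v} => ?_⟩⟩⟩
  refine (SimpleGraph.fromRel_adj _ _ _).trans ?_
  refine (and_congr hinj.ne_iff (or_congr (realize_idTransduction G.graph _ u v)
    (realize_idTransduction G.graph _ v u))).trans ?_
  rw [G.graph.adj_comm v u, or_self]
  exact and_iff_right_of_imp fun h => h.ne

/-- The transduction with two copies that joins a vertex of the first color to a vertex of the second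
color if one lies in the closed neighborhood of the other. -/
def closedNbhdTransduction : Transduction where
  copies := 2
  colors := 2
  formula :=
    FirstOrder.Language.Relations.formula₁ (L := copyLang 2) (CopyRel.color 0)
        (FirstOrder.Language.Term.var 0) ⊓
      FirstOrder.Language.Relations.formula₁ (L := copyLang 2) (CopyRel.color 1)
        (FirstOrder.Language.Term.var 1) ⊓
      (FirstOrder.Language.Relations.formula₂ (L := copyLang 2) CopyRel.cp
          (FirstOrder.Language.Term.var 0) (FirstOrder.Language.Term.var 1) ⊔
        FirstOrder.Language.BoundedFormula.ex
          (FirstOrder.Language.Relations.boundedFormula₂ (L := copyLang 2) CopyRel.cp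
              (FirstOrder.Language.Term.var (Sum.inr 0))
              (FirstOrder.Language.Term.var (Sum.inl 1)) ⊓
            FirstOrder.Language.Relations.boundedFormula₂ (L := copyLang 2) CopyRel.adj
              (FirstOrder.Language.Term.var (Sum.inl 0))
              (FirstOrder.Language.Term.var (Sum.inr 0))))

theorem realize_closedNbhdTransduction {V : Type} (G : SimpleGraph V)
    (M : Fin 2 → Set (V × Fin 2)) (a b : V × Fin 2) :
    @FirstOrder.Language.Formula.Realize (copyLang 2) (V × Fin 2) (coloredCopy G 2 M) (Fin 2)
      closedNbhdTransduction.formula ![a, b] ↔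
      a ∈ M 0 ∧ b ∈ M 1 ∧ b.1 ∈ closedNbhd G a.1 := by
  let := coloredCopy G 2 M
  unfold closedNbhdTransduction FirstOrder.Language.Formula.Realize
  simp only [FirstOrder.Language.BoundedFormula.realize_inf,
    FirstOrder.Language.BoundedFormula.realize_sup, FirstOrder.Language.BoundedFormula.realize_ex,
    FirstOrder.Language.BoundedFormula.realize_rel₂]
  change ((a ∈ M 0 ∧ b ∈ M 1) ∧ (a.1 = b.1 ∨ ∃ z : V × Fin 2, z.1 = b.1 ∧ (a.2 = z.2 ∧ G.Adj a.1 z.1)))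
    ↔ _
  have : (∃ z : V × Fin 2, z.1 = b.1 ∧ (a.2 = z.2 ∧ G.Adj a.1 z.1)) ↔ G.Adj a.1 b.1 := by
    constructor
    · rintro ⟨z, hz, -, hadj⟩
      rwa [hz] at hadj
    · exact fun h => ⟨(b.1, a.2), rfl, rfl, h⟩
  rw [this, and_assoc]
  simp only [closedNbhd, Set.mem_insert_iff, SimpleGraph.mem_neighborSet, eq_comm (a := a.1)]

/-- A half-graph between two sequences of vertices, with respect to closed neighborhoods, can be
transduced.  The sequences are placed in different copies, since they may have vertices in common. -/
theorem halfGraph_mem_image {C : Set FinGraph} {G : FinGraph} (hG : G ∈ C) {t : ℕ} (x y : Fin t → G.V)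
    (hxy : ∀ a b, y b ∈ closedNbhd G.graph (x a) ↔ a ≤ b) :
    halfGraph t ∈ closedNbhdTransduction.image C := by
  have hx : ∀ a a', x a = x a' → a = a' := fun a a' h =>
    le_antisymm ((hxy a a').1 (h ▸ (hxy a' a').2 le_rfl)) ((hxy a' a).1 (h ▸ (hxy a a).2 le_rfl))
  have hy : ∀ b b', y b = y b' → b = b' := fun b b' h =>
    le_antisymm ((hxy b b').1 (h ▸ (hxy b b).2 le_rfl)) ((hxy b' b).1 (h ▸ (hxy b' b').2 le_rfl))
  set f : Fin t ⊕ Fin t → G.V × Fin 2 := Sum.elim (fun a => (x a, 0)) fun b => (y b, 1) with hf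
  set M : Fin 2 → Set (G.V × Fin 2) := ![Set.range fun a => (x a, 0), Set.range fun b => (y b, 1)]
    with hM
  have hfinj : Function.Injective f := by
    rintro (a | a) (b | b) h <;> simp [hf] at h
    · rw [hx a b h]
    · rw [hy a b h]
  have key : ∀ u v, (f u ∈ M 0 ∧ f v ∈ M 1 ∧ (f v).1 ∈ closedNbhd G.graph (f u).1) ↔
      ∃ i j : Fin t, u = Sum.inl i ∧ v = Sum.inr j ∧ i ≤ j := by
    rintro (a | a) (b | b) <;> simp [hf, hM, hxy]
  refine Set.mem_iUnion₂.2 ⟨G, hG, M, ⟨⟨⟨f, hfinj⟩, ?_⟩⟩⟩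
  intro u v
  refine (SimpleGraph.fromRel_adj _ _ _).trans (Iff.trans ?_ (SimpleGraph.fromRel_adj _ _ _).symm)
  exact and_congr hfinj.ne_iff (or_congr
    ((realize_closedNbhdTransduction _ _ _ _).trans (key u v))
    ((realize_closedNbhdTransduction _ _ _ _).trans (key v u)))

theorem MonadicallyStable.exists_noHalfGraph {C : Set FinGraph} (h : MonadicallyStable C) :
    ∃ t, ∀ G ∈ C, NoHalfGraph (fun w x : G.V => x ∈ closedNbhd G.graph w) t := by
  by_contra! hcon
  refine h ⟨closedNbhdTransduction, ?_⟩
  rintro _ ⟨t, rfl⟩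
  obtain ⟨G, hG, hn⟩ := hcon t
  rw [NoHalfGraph, not_not] at hn
  obtain ⟨x, y, hxy⟩ := hn
  exact halfGraph_mem_image hG x y hxy

theorem InherentlyLinearNbhdComplexity.exists_linearTraces {C : Set FinGraph}
    (h : InherentlyLinearNbhdComplexity C) :
    ∃ c, ∀ G ∈ C, ∀ [Fintype G.V] [DecidableEq G.V]
      [∀ w : G.V, DecidablePred fun x => x ∈ closedNbhd G.graph w],
      LinearTraces (fun w x : G.V => x ∈ closedNbhd G.graph w) c := by
  obtain ⟨c, hc⟩ := h idTransduction
  refine ⟨c + 1, fun G hG _ _ _ S => ?_⟩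
  classical
  rcases S.eq_empty_or_nonempty with rfl | hS
  · refine (card_le_card (t := {∅}) fun t ht => ?_).trans (by simp)
    obtain ⟨x, -, rfl⟩ := mem_image.1 ht
    simp
  have h₁ : #(univ.image fun v : G.V => S.filter (G.graph.Adj v)) ≤ c * #S := by
    have := hc G (mem_image_idTransduction hG) S hS
    rw [Set.ncard_coe_finset] at this
    refine le_trans (le_of_eq ?_) this
    rw [← Set.ncard_coe_finset, ← Set.ncard_image_of_injective _ coe_injective]
    congr 1
    ext t
    simp only [Set.mem_image, mem_coe, mem_image, mem_univ, true_and, Set.mem_range]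
    constructor
    · rintro ⟨_, ⟨v, rfl⟩, rfl⟩
      exact ⟨v, by ext z; simp [and_comm]⟩
    · rintro ⟨v, rfl⟩
      exact ⟨_, ⟨v, rfl⟩, by ext z; simp [and_comm]⟩
  -- closed and open neighborhoods have the same trace, except for those of the vertices in `S`
  have h₂ : (univ.image fun w : G.V => S.filter fun x => x ∈ closedNbhd G.graph w) ⊆
      (univ.image fun v : G.V => S.filter (G.graph.Adj v)) ∪
        S.image fun w : G.V => S.filter fun x => x ∈ closedNbhd G.graph w := by
    intro t ht
    obtain ⟨w, -, rfl⟩ := mem_image.1 ht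
    by_cases hw : w ∈ S
    · exact mem_union_right _ (mem_image_of_mem _ hw)
    · refine mem_union_left _ (mem_image.2 ⟨w, mem_univ _, filter_congr fun x hx => ?_⟩)
      have : x ≠ w := fun h => hw (h ▸ hx)
      simp [closedNbhd, this]
  have h₃ := (card_le_card h₂).trans (card_union_le _ _)
  have h₄ : #(S.image fun w : G.V => S.filter fun x => x ∈ closedNbhd G.graph w) ≤ #S :=
    card_image_le
  nlinarith

/-! ### The cover -/

theorem wordFits_wordBound (n : ℕ) : Expr.WordFits (wordBound 4 n) n := by
  unfold Expr.WordFits wordBound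
  have : (n + 2) ^ 4 = (n + 2) ^ 2 * (n + 2) ^ 2 := by ring
  rw [this]
  nlinarith [Nat.zero_le n]

open Classical in
theorem heap_inputState (G : FinGraph) (e : G.V ≃ Fin G.order) :
    Heap G.order (fun i j => if ∃ u v : G.V, G.graph.Adj u v ∧ i = e u ∧ j = e v then 1 else 0)
      (fun _ => 0) (fun _ => 0) (fun _ => 0) (inputState G e) := by
  have hzero : ∀ a, G.order * G.order ≤ a → (inputState G e).mem a = 0 := by
    intro a ha
    refine if_neg ?_
    rintro ⟨u, v, -, rfl⟩
    exact absurd (index_lt (e u).2 (e v).2) (not_lt.2 ha)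
  refine ⟨by simp [inputState], fun i hi j hj => ?_, fun i hi => hzero _ (by omega),
    fun i hi => hzero _ (by omega), fun i hi => hzero _ (by omega), fun i hi j hj => ?_,
    by simp, by simp, by simp⟩
  · have : (∃ u v : G.V, G.graph.Adj u v ∧ i * G.order + j = (e u : ℕ) * G.order + (e v : ℕ)) ↔
        ∃ u v : G.V, G.graph.Adj u v ∧ i = e u ∧ j = e v :=
      exists_congr fun u => exists_congr fun v => and_congr_right fun _ =>
        ⟨fun h => index_inj hj (e v).2 h, fun h => by rw [h.1, h.2]⟩
    simp only [inputState, this]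
  · split_ifs <;> omega

theorem mem_closedNbhd_comm {V : Type} {G : SimpleGraph V} {x y : V} :
    x ∈ closedNbhd G y ↔ y ∈ closedNbhd G x := by
  simp only [closedNbhd, Set.mem_insert_iff, SimpleGraph.mem_neighborSet, G.adj_comm x, eq_comm]

theorem mem_closedNbhdSet {V : Type} {G : SimpleGraph V} {P : Set V} {v : V} :
    v ∈ closedNbhdSet G P ↔ ∃ w ∈ P, v ∈ closedNbhd G w := by
  simp [closedNbhdSet]

section FiberCover

variable {V : Type} {G : SimpleGraph V} (f : V → V)

/-- The clusters `N[P]`, where `P` ranges over the nonempty fibers of `f`. -/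
def fiberCover (G : SimpleGraph V) (f : V → V) : Set (Set V) :=
  Set.range fun a => closedNbhdSet G {w | f w = f a}

theorem isNbhdCover_fiberCover : IsNbhdCover G (fiberCover G f) := fun v =>
  ⟨_, ⟨v, rfl⟩, fun _ hx => mem_closedNbhdSet.2 ⟨v, rfl, hx⟩⟩

theorem isCompactCover_fiberCover (hf : ∀ w, f w ∈ closedNbhd G w) :
    IsCompactCover G (fiberCover G f) := by
  refine ⟨(Setoid.ker f).classes, Setoid.isPartition_classes _, ?_, ?_⟩
  · rintro _ ⟨a, rfl⟩
    refine ⟨f a, fun w hw => ?_⟩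
    have hw : f w = f a := hw
    rw [← hw]
    exact mem_closedNbhd_comm.1 (hf w)
  · rintro _ ⟨a, rfl⟩
    exact ⟨_, ⟨a, rfl⟩, rfl⟩

theorem overlapAtMost_fiberCover [Fintype V] [DecidableEq V]
    [∀ v, DecidablePred fun w => v ∈ closedNbhd G w] {k : ℕ}
    (hk : ∀ v, #(image f {w | v ∈ closedNbhd G w}) ≤ k) : OverlapAtMost (fiberCover G f) k := by
  intro v
  have hsub : {A ∈ fiberCover G f | v ∈ A} ⊆
      (fun u => closedNbhdSet G {w | f w = u}) '' (image f {w | v ∈ closedNbhd G w} : Finset V) := by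
    rintro _ ⟨⟨a, rfl⟩, hv⟩
    obtain ⟨w, hw, hvw⟩ := mem_closedNbhdSet.1 hv
    have hw : f w = f a := hw
    exact ⟨f a, by rw [← hw]; exact mem_coe.2 (mem_image_of_mem _ (by simpa using hvw)), rfl⟩
  refine (Set.encard_le_encard hsub).trans ((Set.encard_image_le _ _).trans ?_)
  rw [Set.encard_coe_eq_coe_finsetCard]
  exact_mod_cast hk v

end FiberCover

/-- The program computes the cover by the neighborhoods of the sets of vertices with equal centers. -/
theorem coverProg_correct {c t : ℕ} {G : FinGraph}
    (hn : NoHalfGraph (fun w x : G.V => x ∈ closedNbhd G.graph w) t)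
    (hc : ∀ [Fintype G.V] [DecidableEq G.V]
      [∀ w : G.V, DecidablePred fun x => x ∈ closedNbhd G.graph w],
      LinearTraces (fun w x : G.V => x ∈ closedNbhd G.graph w) c)
    (e : G.V ≃ Fin G.order) :
    ∃ (T : ℕ) (s : RamState) (f : G.V → G.V),
      RamExec (wordBound 4 G.order) coverProg (inputState G e) T s ∧ T ≤ 1200 * (G.order ^ 4 + 1) ∧
      outputClusters G e s = fiberCover G.graph f ∧ (∀ w, f w ∈ closedNbhd G.graph w) ∧
      OverlapAtMost (fiberCover G.graph f) (walkBound (twinBound c) (treeDepth (t + (t + 1)))) := by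
  classical
  have := Fintype.ofFinite G.V
  obtain ⟨T, s₁, s', hexec, hT, hag, h0, M, σ, A, K, hM, hσ, hout⟩ :=
    runs_coverProg (heap_inputState G e) (wordFits_wordBound _) _ (Agree.refl _)
  have hM' : ∀ x y : G.V, M (e x) (e y) = if y ∈ closedNbhd G.graph x then 1 else 0 := by
    intro x y
    rw [hM _ (e x).2 _ (e y).2]
    have h₁ : (∃ u v : G.V, G.graph.Adj u v ∧ (e x : ℕ) = e u ∧ (e y : ℕ) = e v) ↔
        G.graph.Adj x y := by
      constructor
      · rintro ⟨u, v, huv, hu, hv⟩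
        rwa [e.injective (Fin.ext hu), e.injective (Fin.ext hv)]
      · exact fun h => ⟨x, y, h, rfl, rfl⟩
    have h₂ : (e x : ℕ) = e y ↔ y = x :=
      ⟨fun h => (e.injective (Fin.ext h)).symm, fun h => by rw [h]⟩
    simp only [h₁, h₂, closedNbhd, Set.mem_insert_iff, SimpleGraph.mem_neighborSet]
    split_ifs <;> tauto
  obtain ⟨f, hfK, hf, hbound⟩ := hσ.exists_center (r := fun w x : G.V => x ∈ closedNbhd G.graph w) e
    hc hn (fun x => Set.mem_insert _ _) (fun x y h => mem_closedNbhd_comm.1 h) hM'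
  refine ⟨T, s₁, f, hexec, hT, ?_, hf, overlapAtMost_fiberCover f hbound⟩
  have hcluster : ∀ a : G.V, {v : G.V | s₁.mem (s₁.reg 1 + (e a : ℕ) * G.order + (e v : ℕ)) = 1} =
      closedNbhdSet G.graph {w | f w = f a} := by
    intro a
    ext v
    rw [Set.mem_ofPred_eq, hag.1, hag.2 1 (by norm_num), add_assoc, hout _ (e a).2 _ (e v).2,
      mem_closedNbhdSet]
    constructor
    · rintro ⟨w, hw, h₁, h₂⟩
      have hew : (e (e.symm ⟨w, hw⟩) : ℕ) = w := by simp
      rw [← hew, hM'] at h₁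
      rw [← hew, ← hfK, ← hfK] at h₂
      refine ⟨e.symm ⟨w, hw⟩, e.injective (Fin.ext h₂), ?_⟩
      by_contra h'
      rw [mem_closedNbhd_comm] at h'
      rw [if_neg h'] at h₁
      exact absurd h₁ (by norm_num)
    · rintro ⟨w, hw, hvw⟩
      refine ⟨e w, (e w).2, ?_, ?_⟩
      · rw [hM', if_pos (mem_closedNbhd_comm.1 hvw)]
      · have hw : f w = f a := hw
        rw [← hfK, ← hfK, hw]
  ext B
  constructor
  · rintro ⟨i, hi, rfl⟩
    rw [hag.2 0 (by norm_num), h0] at hi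
    refine ⟨e.symm ⟨i, hi⟩, ?_⟩
    refine (hcluster _).symm.trans ?_
    simp
  · rintro ⟨a, rfl⟩
    refine ⟨e a, ?_, ?_⟩
    · rw [hag.2 0 (by norm_num), h0]; exact (e a).2
    · exact (hcluster a).symm

end CompactCovers

theorem mainTheorem4 (C : Set CompactCovers.FinGraph)
    (hstable : CompactCovers.MonadicallyStable C)
    (hlinear : CompactCovers.InherentlyLinearNbhdComplexity C) :
    ∃ (k : ℕ) (p : CompactCovers.RamProg), CompactCovers.ComputesCompactCovers p C k := by
  obtain ⟨t, ht⟩ := hstable.exists_noHalfGraph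
  obtain ⟨c, hc⟩ := hlinear.exists_linearTraces
  refine ⟨CompactCovers.walkBound (CompactCovers.twinBound c)
    (CompactCovers.treeDepth (t + (t + 1))), CompactCovers.coverProg, 1200, 4, fun G hG e => ?_⟩
  obtain ⟨T, s, f, hexec, hT, hout, hf, hk⟩ := CompactCovers.coverProg_correct (c := c) (ht G hG)
    (hc G hG) e
  refine ⟨T, s, hexec, hT, ?_, ?_, ?_⟩
  · rw [hout]; exact CompactCovers.isNbhdCover_fiberCover f
  · rw [hout]; exact CompactCovers.isCompactCover_fiberCover f hf
  · rw [hout]; exact hk
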